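/- **Setting.** Let $J\ge 1$. For $j=1,\dots,J$ the service time $S_j$ of a packet on server $j$ is discrete phase-type, $S_j\sim\mathrm{DPH}(\alpha_j,D_j)$ with $M_j$ phases: it is the time to absorption in a Markov chain with $M_j$ transient states, initial probability vector $\alpha_j$ ($\alpha_j\mathbf 1=1$) and substochastic transient matrix $D_j$ with $I-D_j$ invertible; put $d_j=\mathbf 1-D_j\mathbf 1$. Service times of different packets are independent. Let $0=\tau_0<\tau_1\le\tau_2<\tau_3<\dots<\tau_J<\tau_{J+1}=\infty$ be integers. In slot $k$ the following happens in this order. (1) It is checked whether the packet under transmission, if any, is received. (2) The age becomes $\Delta_k=k-g$ if a packet generated in slot $g$ is received in slot $k$, and $\Delta_k=\Delta_{k-1}+1$ otherwise. (3) If no packet is under transmission, the source waits if $\Delta_k<\tau_1$, and otherwise generates a packet and starts to transmit it, on server $1$ if $\tau_1\le\Delta_k\le\tau_2$ and on server $j\ge2$ if $\tau_j<\Delta_k\le\tau_{j+1}$. A packet generated in slot $g$ with service time $s$ is received in slot $g+s$. The system starts with an arbitrary age $\Delta_0=a_0$ and a free link. Consider the absorbing chain $X_k$ with transient states $(1,j,m)$,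 $(2,j,m)$ ($1\le j\le J$, $1\le m\le M_j$, all states $(1,\cdot,\cdot)$ being listed before the states $(2,\cdot,\cdot)$) and absorbing states $1,\dots,J$. For times $k$ in regime $i$, that is $\tau_{i-1}\le k<\tau_i$, $i=1,\dots,I=J+1$, its transient matrix $A_i$ and absorption matrix $B_i$ are as follows. The block $(1,j,\cdot)\to(1,j,\cdot)$ of $A_i$ is $D_j$; the block $(1,j,\cdot)\to(2,\max(i-1,1),\cdot)$ is $d_j\alpha_{\max(i-1,1)}$; the block $(2,j,\cdot)\to(2,j,\cdot)$ is $D_j$ if $j<i$ and the identity if $j\ge i$; for $j<i$ the block of $B_i$ from $(2,j,\cdot)$ to absorbing state $j$ is $d_j$; all other blocks vanish. Let $\delta_i=\tau_i-\tau_{i-1}$ and $$\Psi=\sum_{i=1}^{J}A_1^{\delta_1}\cdots A_{i-1}^{\delta_{i-1}}\Big(\sum_{l=0}^{\delta_i-1}A_i^l\Big)B_i+A_1^{\delta_1}\cdots A_{J}^{\delta_{J}}(I-A_I)^{-1}B_I ,$$ let $\mathbf A$ be the matrix with $J$ rows whose $j$-th row is $\alpha_j$ on the states $(1,j,\cdot)$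 and zero elsewhere, and assume that the stochastic matrix $\mathbf A\Psi$ has a unique stationary probability vector $\kappa$. The initial probability vector of $X$ is $\beta_1=\kappa\mathbf A$; put $\beta_{i+1}=\beta_iA_i^{\delta_i}$ for $1\le i\le J$. Let $x_n$ be the row vector of the probabilities of the transient states at time $n$, let $\mathcal C=\{(2,\cdot,\cdot)\}$, and let $h$ be the column vector whose last $M_1+\dots+M_J$ entries (those of $\mathcal C$) are one, the others being zero. **Theorem.** There is a probability mass function $p_\Delta$ on $\{1,2,\dots\}$ that is the steady-state law of the age of information: for each $n$, almost surely $\frac1K\#\{1\le k\le K:\Delta_k=n\}\to p_\Delta(n)$, also $\frac1K\sum_{k=1}^K\Pr(\Delta_k=n)\to p_\Delta(n)$, and whenever $\lim_{k\to\infty}\Pr(\Delta_k=n)$ exists, it equals $p_\Delta(n)$. Moreover: 1. $p_\Delta(n)=\eta\,\Pr(X_n\in\mathcal C)=\eta\,x_nh$ for all $n$, where $\eta>0$ and $$\eta^{-1}=\beta_I(I-A_I)^{-1}h+\sum_{i=1}^{J}\ \sum_{m=\tau_{i-1}}^{\tau_i-1}\beta_iA_i^{\,m-\tau_{i-1}}h=\sum_{n\ge0}\Pr(X_n\in\mathcal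 C)$$ is the mean cycle length: almost surely, $K$ divided by the number of packets received in slots $1,\dots,K$ tends to $\eta^{-1}$. 2. $x_n=\beta_iA_i^{\,n-\tau_{i-1}}$, hence $p_\Delta(n)=\eta\,\beta_iA_i^{\,n-\tau_{i-1}}h$, for $\tau_{i-1}\le n<\tau_i$, $1\le i\le I$. 3. For every $f$ with $\sum_{n\ge1}|f(n)|\,p_\Delta(n)<\infty$, almost surely $\frac1K\sum_{k=1}^Kf(\Delta_k)\to\sum_{n\ge1}f(n)\,p_\Delta(n)$. In particular $\mathbb E[\Delta]$ is finite and $$\mathbb E[\Delta]=\sum_{n=1}^{\tau_J-1}n\,p_\Delta(n)+\eta\,\beta_I\big(\tau_J(I-A_I)^{-1}+(I-A_I)^{-2}A_I\big)h .$$ 4. Almost surely, the fraction of slots in which the source waits (no packet is under transmission after the decision) tends to $p_W=\sum_{n=1}^{\tau_1-1}p_\Delta(n)$. The service times have finite means, and almost surely the number of transmissions started on server $j$ per slot tends to $$f_j=(1-p_W)\,\frac{\kappa_j}{\sum_{l=1}^J\kappa_l\,\mathbb E[S_l]},$$ so that, with cost $c_j$ per transmission on server $j$, the time-averaged transmission cost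 tends almost surely to $\sum_{j=1}^Jc_jf_j$. -/

import Mathlib

open MeasureTheory ProbabilityTheory Filter Topology Matrix

noncomputable section

/-- `X` is a Markov chain on the finite or countable set `E` with initial probabilities `init` and
one-step transition matrix `Q k` from time `k` to time `k + 1`, expressed through its
finite-dimensional distributions. -/
def IsMarkovChain {E Ω : Type*} [MeasurableSpace Ω] (ν : Measure Ω) (X : ℕ → Ω → E)
    (init : E → ℝ) (Q : ℕ → Matrix E E ℝ) : Prop :=
  (∀ k s, MeasurableSet {ω | X k ω = s}) ∧
  ∀ (n : ℕ) (s : ℕ → E),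
    ν.real {ω | ∀ k ≤ n, X k ω = s k} = init (s 0) * ∏ k ∈ Finset.range n, Q k (s k) (s (k + 1))

/-- The transition matrix of an absorbing chain with transient matrix `A` and absorption
matrix `B`. -/
def absorbingMatrix {T U : Type*} [DecidableEq U] (A : Matrix T T ℝ) (B : Matrix T U ℝ) :
    Matrix (T ⊕ U) (T ⊕ U) ℝ :=
  Matrix.fromBlocks A B 0 1

/-- The absorption vector `1 - A 1` of a transient matrix. -/
def absorptionVector {M : ℕ} (A : Matrix (Fin M) (Fin M) ℝ) : Fin M → ℝ :=
  fun m => 1 - ∑ m', A m m'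

/-- `T ∼ DPH(β, A)`: the random variable `T` has the law of the time until absorption in a Markov
chain with `M` transient states, one absorbing state, initial probabilities `β` on the transient
states, and transient matrix `A`. -/
def IsDPH {Ω : Type*} [MeasurableSpace Ω] (P : Measure Ω) (T : Ω → ℕ) {M : ℕ}
    (β : Fin M → ℝ) (A : Matrix (Fin M) (Fin M) ℝ) : Prop :=
  ∃ (Ω' : Type) (_ : MeasurableSpace Ω') (ν : Measure Ω') (Y : ℕ → Ω' → Fin M ⊕ Unit),
    IsProbabilityMeasure ν ∧
    IsMarkovChain ν Y (Sum.elim β 0)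
      (fun _ => absorbingMatrix A (Matrix.of fun m (_ : Unit) => absorptionVector A m)) ∧
    ∀ n : ℕ, P {ω | T ω = n} =
      ν {ω | Y n ω = Sum.inr () ∧ ∀ m < n, Y m ω ≠ Sum.inr ()}

/-- A status update system with `J` servers and a multi-threshold policy. Server number `j + 1` of
the usual numbering `1, …, J` is `j : Fin J`; the thresholds are `τ 1, …, τ J`, with `τ 0 = 0`, the
threshold of number `J + 1` being infinite (values of `τ` beyond `J` play no role). -/
structure ServerSystem (J : ℕ) where
  /-- number of phases of each service time -/
  order : Fin J → ℕ
  /-- initial phase probabilities of the service times -/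
  α : (j : Fin J) → Fin (order j) → ℝ
  /-- transient matrices of the service times -/
  D : (j : Fin J) → Matrix (Fin (order j)) (Fin (order j)) ℝ
  /-- thresholds -/
  τ : ℕ → ℕ
  /-- cost of one transmission on each server -/
  cost : Fin J → ℝ
  α_nonneg : ∀ j m, 0 ≤ α j m
  α_sum : ∀ j, ∑ m, α j m = 1
  D_nonneg : ∀ j m m', 0 ≤ D j m m'
  D_sum_le : ∀ j m, ∑ m', D j m m' ≤ 1
  /-- absorption is certain: the fundamental matrix exists -/
  D_fundamental : ∀ j, IsUnit (1 - D j)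
  τ_zero : τ 0 = 0
  τ_one_pos : 0 < τ 1
  τ_one_le_two : 2 ≤ J → τ 1 ≤ τ 2
  τ_lt : ∀ j, 2 ≤ j → j < J → τ j < τ (j + 1)

namespace ServerSystem

variable {J : ℕ} (N : ServerSystem J)

/-! ### The update system and its age process -/

/-- `N.Uses j a`: the policy uses server `j` for a new packet when the link is free and the age is
`a`, that is `τ_j < a ≤ τ_{j+1}` in the numbering `1, …, J`, the first server being also used
at age `τ_1`. -/
def Uses (j : Fin J) (a : ℕ) : Prop :=
  (N.τ (j + 1) < a ∧ ((j : ℕ) + 1 < J → a ≤ N.τ (j + 2))) ∨ ((j : ℕ) = 0 ∧ a = N.τ 1)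

open Classical in
/-- The server selected at age `a` on a free link; `none` means waiting. -/
def select (a : ℕ) : Option (Fin J) :=
  if h : ∃ j, N.Uses j a then some h.choose else none

/-- The situation at the end of a time slot: the age, and, if a packet is under transmission, its
server and its generation slot. -/
structure _root_.LinkState (J : ℕ) where
  age : ℕ
  ongoing : Option (Fin J × ℕ)

/-- With `σ j g` the service time needed on server `j` by a packet generated in slot `g`: the packet
under transmission (if any) is received in slot `k`. -/
def _root_.LinkState.Received {J : ℕ} (σ : Fin J → ℕ → ℕ) (s : LinkState J) (k : ℕ) : Prop :=
  ∃ j g, s.ongoing = some (j, g) ∧ k = g + σ j g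

/-- New transmission (or waiting) in slot `k` on a free link at age `a`. -/
def decide (k a : ℕ) : Option (Fin J × ℕ) := (N.select a).map fun j => (j, k)

open Classical in
/-- Events of slot `k`: check for a reception, update of the age, application of the policy. -/
def step (σ : Fin J → ℕ → ℕ) (k : ℕ) (s : LinkState J) : LinkState J :=
  match s.ongoing with
  | none => ⟨s.age + 1, N.decide k (s.age + 1)⟩
  | some (j, g) =>
    if k = g + σ j g then ⟨k - g, N.decide k (k - g)⟩ else ⟨s.age + 1, some (j, g)⟩

/-- The system path, started in slot `0` with age `a₀` and a free link. -/
def path (σ : Fin J → ℕ → ℕ) (a₀ : ℕ) : ℕ → LinkState J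
  | 0 => ⟨a₀, N.decide 0 a₀⟩
  | k + 1 => N.step σ (k + 1) (path σ a₀ k)

/-- The service times: `S j g` is the service time needed on server `j` by a packet generated in
slot `g`. They are independent, and those of server `j` are `DPH(α_j, D_j)`. -/
structure IsServiceFamily {Ω : Type*} [MeasurableSpace Ω] (P : Measure Ω)
    (S : Fin J → ℕ → Ω → ℕ) : Prop where
  measurable : ∀ j g, Measurable (S j g)
  indep : iIndepFun (fun q : Fin J × ℕ => S q.1 q.2) P
  law : ∀ j g, IsDPH P (S j g) (N.α j) (N.D j)

section processes

variable {Ω : Type*} (S : Fin J → ℕ → Ω → ℕ) (a₀ : ℕ)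

/-- The age of information in slot `k`. -/
def age (k : ℕ) (ω : Ω) : ℕ := (N.path (fun j g => S j g ω) a₀ k).age

open Classical in
/-- Indicator of the event that a transmission on server `j` is started in slot `k`. -/
def started (j : Fin J) (k : ℕ) (ω : Ω) : ℝ :=
  if (N.path (fun i g => S i g ω) a₀ k).ongoing = some (j, k) then 1 else 0

open Classical in
/-- Indicator of the event that no packet is under transmission in slot `k`, after the decision. -/
def waiting (k : ℕ) (ω : Ω) : ℝ :=
  if (N.path (fun i g => S i g ω) a₀ k).ongoing = none then 1 else 0

open Classical in
/-- Number of packets received in the slots `1, …, K`. -/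
def receptions (K : ℕ) (ω : Ω) : ℕ :=
  ((Finset.range K).filter fun k =>
    (N.path (fun i g => S i g ω) a₀ k).Received (fun i g => S i g ω) (k + 1)).card

end processes

/-! ### The multi-regime absorbing Markov chain -/

/-- Pairs of a server and a phase of its service time. -/
abbrev Phase : Type := Σ j : Fin J, Fin (N.order j)

/-- Transient states: `inl (j, m)` stands for `(1, j, m)`, and `inr (j, m)` for `(2, j, m)`. -/
abbrev Transient : Type := N.Phase ⊕ N.Phase

/-- The transient states and the `J` absorbing states. -/
abbrev State : Type := N.Transient ⊕ Fin J

/-- The absorption vector `d_j = 1 - D_j 1` of server `j`. -/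
def d (j : Fin J) : Fin (N.order j) → ℝ := absorptionVector (N.D j)

/-- The transient matrix in the regime `[τ r, τ (r + 1))`, `r = 0, …, J`. -/
def A (r : ℕ) : Matrix N.Transient N.Transient ℝ :=
  Matrix.fromBlocks
    (Matrix.blockDiagonal' N.D)
    (Matrix.of fun s t : N.Phase => if (t.1 : ℕ) = r - 1 then N.d s.1 s.2 * N.α t.1 t.2 else 0)
    0
    (Matrix.blockDiagonal' fun j => if (j : ℕ) < r then N.D j else 1)

/-- The absorption matrix in the regime `[τ r, τ (r + 1))`, `r = 0, …, J`. -/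
def B (r : ℕ) : Matrix N.Transient (Fin J) ℝ :=
  Matrix.of fun s j => Sum.elim (fun _ => 0)
    (fun t : N.Phase => if t.1 = j ∧ (j : ℕ) < r then N.d t.1 t.2 else 0) s

/-- The length of the regime `[τ r, τ (r + 1))`, for `r < J`. -/
def δ (r : ℕ) : ℕ := N.τ (r + 1) - N.τ r

/-- The index `r ∈ {0, …, J}` of the regime `[τ r, τ (r + 1))` that contains the time `k`. -/
def regime (k : ℕ) : ℕ := ((Finset.Icc 1 J).filter fun i => N.τ i ≤ k).card

/-- The product of the powers `A_i ^ δ_i` over the first `r` regimes. -/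
def regimeProd : ℕ → Matrix N.Transient N.Transient ℝ
  | 0 => 1
  | r + 1 => regimeProd r * N.A r ^ N.δ r

/-- The absorption probabilities, by initial transient state. -/
def Ψ : Matrix N.Transient (Fin J) ℝ :=
  (∑ r ∈ Finset.range J, N.regimeProd r * (∑ l ∈ Finset.range (N.δ r), N.A r ^ l) * N.B r) +
    N.regimeProd J * (1 - N.A J)⁻¹ * N.B J

/-- The matrix whose row `j` is `α_j` placed on the states `(1, j, ·)`. -/
def initMatrix : Matrix (Fin J) N.Transient ℝ :=
  Matrix.of fun j s => Sum.elim (fun t : N.Phase => if t.1 = j then N.α t.1 t.2 else 0)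
    (fun _ => 0) s

/-- The transition matrix of the servers of successive packets. -/
def serverMatrix : Matrix (Fin J) (Fin J) ℝ := N.initMatrix * N.Ψ

/-- `κ` is a stationary probability vector of the server chain. -/
structure IsStationary (κ : Fin J → ℝ) : Prop where
  nonneg : ∀ j, 0 ≤ κ j
  sum_eq_one : ∑ j, κ j = 1
  stationary : κ ᵥ* N.serverMatrix = κ

/-- The probability vectors `β` at the beginning of the regimes. -/
def β (κ : Fin J → ℝ) : ℕ → N.Transient → ℝ
  | 0 => κ ᵥ* N.initMatrix
  | r + 1 => β κ r ᵥ* N.A r ^ N.δ r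

/-- `X` is the multi-regime absorbing Markov chain of the system. -/
def IsMRAMC (κ : Fin J → ℝ) {Ω : Type*} [MeasurableSpace Ω] (ν : Measure Ω)
    (X : ℕ → Ω → N.State) : Prop :=
  IsMarkovChain ν X (Sum.elim (N.β κ 0) 0)
    (fun k => absorbingMatrix (N.A (N.regime k)) (N.B (N.regime k)))

/-- The set of the states `(2, ·, ·)`. -/
def C : Set N.State := {s | ∃ t : N.Phase, s = Sum.inl (Sum.inr t)}

/-- The indicator vector of `C` among the transient states: zero on the first half of the
entries and one on the second half. -/
def h : N.Transient → ℝ := Sum.elim (fun _ => 0) (fun _ => 1)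

/-- The transient probability vector `x_n`. -/
def x {Ω : Type*} [MeasurableSpace Ω] (ν : Measure Ω) (X : ℕ → Ω → N.State) (n : ℕ) :
    N.Transient → ℝ :=
  fun s => ν.real {ω | X n ω = Sum.inl s}

/-- The normalizing constant `η⁻¹`. -/
def meanCycle (κ : Fin J → ℝ) : ℝ :=
  (N.β κ J ᵥ* (1 - N.A J)⁻¹) ⬝ᵥ N.h +
    ∑ r ∈ Finset.range J, ∑ m ∈ Finset.Ico (N.τ r) (N.τ (r + 1)),
      (N.β κ r ᵥ* N.A r ^ (m - N.τ r)) ⬝ᵥ N.h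

end ServerSystem

end

/-!
# The steady-state law of the age of information under a multi-threshold policy

The path of the system splits into cycles between successive receptions. If two successive packets
have service times `v` and `w`, then the second one is generated at age `max v τ₁`, on a server
`server v` that depends on `v` only, and the ages taken between the two receptions are
`v, v + 1, …, max v τ₁ + w - 1` (`sum_cycle`, `sum_cycle_age`). Time averages of functions of the
age are therefore averages of functions of two successive service times, divided by the mean cycle
length (`tendsto_average_of_cycles`).

*Law of large numbers.* Different packets are generated in different slots, so the service times of
the successive packets are read from distinct entries of an independent table, and the law of each
one, given the past, depends on the current server only (`IsServiceFamily.isDriven`). This rule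
determines the joint law (`IsDriven.ae_of_ae`). In a second construction, the machine takes the
input of its `m`-th visit to server `l` from entry `(l, m)` of an independent table; there, the
classical law of large numbers for each `l` gives the averages of functions of one service time
(`IsDriven.ae_tendsto`), and, after grouping inputs two by two, of two successive ones
(`IsDriven.ae_tendsto_pair`). No recurrence is needed for this: the servers form a finite Markov
chain, each cluster point of their empirical frequencies is a stationary law, and by uniqueness the
frequencies tend to `κ` (`tendsto_frequency`). Servers with `κ l = 0` are left for good
(`eventually_pos_of_frequency`).

*Identification of the limit.* The chain `X` follows two successive packets: the states
`(1, j, ·)` carry the service of the first one, and the states `(2, j, ·)` the second one from the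
reception of the first until its own. Its transient law has an explicit form (`flow_inl`,
`flow_inr`), which shows that `X n ∈ C` has the probability that age `n` is taken during a
stationary cycle (`IsServiceLaw.sum_real_cycleSet`). The conservation of mass in the states
`(2, j, ·)` shows that `serverMatrix` is the transition matrix of the servers
(`tendsto_sum_prob`, `IsServiceLaw.serverMatrix_eq`). The matrix formulas come from the Neumann
series of the transient matrix of the last regime, which converges because a nonnegative
substochastic matrix `D` with `1 - D` invertible has powers that tend to zero
(`tendsto_pow_apply_zero`).
-/

noncomputable section

/-! ### Powers of substochastic matrices -/

section Substochastic

variable {ι : Type*} [Fintype ι] [DecidableEq ι] {D : Matrix ι ι ℝ}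

/-- The row sums of the powers decrease to a vector fixed by `D`, which vanishes when `1 - D` is
invertible. -/
lemma tendsto_pow_apply_zero (h0 : ∀ i j, 0 ≤ D i j) (h1 : ∀ i, ∑ j, D i j ≤ 1)
    (hu : IsUnit (1 - D)) (i j : ι) : Tendsto (fun n => (D ^ n) i j) atTop (𝓝 0) := by
  set w : ℕ → ι → ℝ := fun n => (D ^ n) *ᵥ 1 with hw
  have hw0 : ∀ n i, 0 ≤ w n i := fun n i => by
    simp only [hw, Matrix.mulVec, dotProduct, Pi.one_apply, mul_one]
    exact Finset.sum_nonneg fun k _ => Matrix.pow_apply_nonneg h0 n i k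
  have hD1 : ∀ i, (D *ᵥ 1) i ≤ 1 := fun i => by
    simpa [Matrix.mulVec, dotProduct] using h1 i
  have hanti : ∀ i, Antitone fun n => w n i := fun i => antitone_nat_of_succ_le fun n => by
    simp only [hw, pow_succ, ← Matrix.mulVec_mulVec]
    simp only [Matrix.mulVec, dotProduct] at hD1 ⊢
    refine Finset.sum_le_sum fun k _ => mul_le_mul_of_nonneg_left ?_
      (Matrix.pow_apply_nonneg h0 n i k)
    simpa using hD1 k
  have hlim : ∀ i, Tendsto (fun n => w n i) atTop (𝓝 (⨅ n, w n i)) := fun i =>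
    tendsto_atTop_ciInf (hanti i) ⟨0, by rintro _ ⟨n, rfl⟩; exact hw0 n i⟩
  set v : ι → ℝ := fun i => ⨅ n, w n i with hv
  have hfix : D *ᵥ v = v := by
    funext i
    have h2 : Tendsto (fun n => (D *ᵥ w n) i) atTop (𝓝 ((D *ᵥ v) i)) := by
      simp only [Matrix.mulVec, dotProduct]
      exact tendsto_finsetSum _ fun k _ => (hlim k).const_mul _
    have h3 : Tendsto (fun n => (D *ᵥ w n) i) atTop (𝓝 (v i)) := by
      have : (fun n => (D *ᵥ w n) i) = fun n => w (n + 1) i := by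
        funext n
        simp only [hw, pow_succ', ← Matrix.mulVec_mulVec]
      rw [this]
      exact (hlim i).comp (tendsto_add_atTop_nat 1)
    exact tendsto_nhds_unique h2 h3
  have hv0 : v = 0 := by
    have hz : (1 - D) *ᵥ v = 0 := by rw [Matrix.sub_mulVec, Matrix.one_mulVec, hfix, sub_self]
    have := congrArg (fun u => (1 - D)⁻¹ *ᵥ u) hz
    simpa [Matrix.mulVec_mulVec,
      Matrix.nonsing_inv_mul _ ((Matrix.isUnit_iff_isUnit_det _).1 hu)] using this
  have hl := hlim i
  rw [show (⨅ n, w n i) = 0 from congrFun hv0 i] at hl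
  refine squeeze_zero (fun n => Matrix.pow_apply_nonneg h0 n i j) (fun n => ?_) hl
  simp only [hw, Matrix.mulVec, dotProduct, Pi.one_apply, mul_one]
  exact Finset.single_le_sum (f := fun k => (D ^ n) i k)
    (fun k _ => Matrix.pow_apply_nonneg h0 n i k) (Finset.mem_univ j)

lemma hasSum_pow_apply (h0 : ∀ i j, 0 ≤ D i j) (h1 : ∀ i, ∑ j, D i j ≤ 1)
    (hu : IsUnit (1 - D)) (i j : ι) : HasSum (fun n => (D ^ n) i j) ((1 - D)⁻¹ i j) := by
  rw [hasSum_iff_tendsto_nat_of_nonneg (fun n => Matrix.pow_apply_nonneg h0 n i j)]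
  have hdet := (Matrix.isUnit_iff_isUnit_det _).1 hu
  have hgeom : ∀ n, ∑ m ∈ Finset.range n, D ^ m = (1 - D ^ n) * (1 - D)⁻¹ := fun n => by
    rw [← geom_sum_mul_neg, Matrix.mul_assoc, Matrix.mul_nonsing_inv _ hdet, Matrix.mul_one]
  have hEq : (fun n => ∑ m ∈ Finset.range n, (D ^ m) i j) =
      fun n => (1 - D)⁻¹ i j - ∑ k, (D ^ n) i k * (1 - D)⁻¹ k j := by
    funext n
    have := congrFun (congrFun (hgeom n) i) j
    rw [Matrix.sum_apply] at this
    rw [this, Matrix.sub_mul, Matrix.one_mul, Matrix.sub_apply, Matrix.mul_apply]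
  rw [hEq]
  have : Tendsto (fun n => ∑ k, (D ^ n) i k * (1 - D)⁻¹ k j) atTop (𝓝 0) := by
    rw [show (0 : ℝ) = ∑ k, 0 * (1 - D)⁻¹ k j by simp]
    exact tendsto_finsetSum _ fun k _ => (tendsto_pow_apply_zero h0 h1 hu i k).mul_const _
  simpa using this.const_sub ((1 - D)⁻¹ i j)

/-- The Cauchy product of the Neumann series with itself. -/
lemma hasSum_succ_mul_pow_apply (h0 : ∀ i j, 0 ≤ D i j) (h1 : ∀ i, ∑ j, D i j ≤ 1)
    (hu : IsUnit (1 - D)) (i j : ι) :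
    HasSum (fun n : ℕ => ((n : ℝ) + 1) * (D ^ n) i j) (((1 - D)⁻¹ ^ 2) i j) := by
  have hk : ∀ k, HasSum (fun n => ∑ m ∈ Finset.range (n + 1), (D ^ m) i k * (D ^ (n - m)) k j)
      ((1 - D)⁻¹ i k * (1 - D)⁻¹ k j) := fun k => by
    have hs := hasSum_pow_apply h0 h1 hu i k
    have ht := hasSum_pow_apply h0 h1 hu k j
    rw [← hs.tsum_eq, ← ht.tsum_eq]
    exact hasSum_sum_range_mul_of_summable_norm (f := fun n => (D ^ n) i k)
      (g := fun n => (D ^ n) k j) hs.summable.norm ht.summable.norm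
  have := hasSum_sum (s := Finset.univ) fun k _ => hk k
  rw [pow_two, Matrix.mul_apply]
  refine this.congr_fun fun n => ?_
  rw [Finset.sum_comm, Finset.sum_congr rfl (g := fun _ => (D ^ n) i j)]
  · simp
  · intro m hm
    rw [← Matrix.mul_apply, ← pow_add,
      Nat.add_sub_cancel' (Nat.lt_succ_iff.1 (Finset.mem_range.1 hm))]

/-- Tested against vectors, the Neumann series of a transient matrix converges to its fundamental
matrix. -/
lemma hasSum_vecMul_pow_dotProduct (h0 : ∀ i j, 0 ≤ D i j) (h1 : ∀ i, ∑ j, D i j ≤ 1)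
    (hu : IsUnit (1 - D)) (a b : ι → ℝ) :
    HasSum (fun n => (a ᵥ* D ^ n) ⬝ᵥ b) ((a ᵥ* (1 - D)⁻¹) ⬝ᵥ b) := by
  simp only [Matrix.vecMul, dotProduct]
  exact hasSum_sum fun j _ => (hasSum_sum fun i _ =>
    (hasSum_pow_apply h0 h1 hu i j).mul_left _).mul_right _

lemma hasSum_succ_mul_vecMul_pow_dotProduct (h0 : ∀ i j, 0 ≤ D i j) (h1 : ∀ i, ∑ j, D i j ≤ 1)
    (hu : IsUnit (1 - D)) (a b : ι → ℝ) :
    HasSum (fun n : ℕ => ((n : ℝ) + 1) * ((a ᵥ* D ^ n) ⬝ᵥ b))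
      ((a ᵥ* (1 - D)⁻¹ ^ 2) ⬝ᵥ b) := by
  have := hasSum_sum (s := Finset.univ) fun j _ => (hasSum_sum (s := Finset.univ) fun i _ =>
    (hasSum_succ_mul_pow_apply h0 h1 hu i j).mul_left (a i)).mul_right (b j)
  simp only [Matrix.vecMul, dotProduct]
  refine this.congr_fun fun n => ?_
  simp only [Finset.mul_sum, Finset.sum_mul]
  exact Finset.sum_congr rfl fun j _ => Finset.sum_congr rfl fun i _ => by ring

lemma tendsto_vecMul_pow_zero (h0 : ∀ i j, 0 ≤ D i j) (h1 : ∀ i, ∑ j, D i j ≤ 1)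
    (hu : IsUnit (1 - D)) (a : ι → ℝ) (j : ι) :
    Tendsto (fun n => (a ᵥ* D ^ n) j) atTop (𝓝 0) := by
  have : Tendsto (fun n => ∑ i, a i * (D ^ n) i j) atTop (𝓝 (∑ i, a i * 0)) :=
    tendsto_finsetSum _ fun i _ => (tendsto_pow_apply_zero h0 h1 hu i j).const_mul _
  simpa [Matrix.vecMul, dotProduct] using this

end Substochastic

/-! ### Marginal laws of Markov chains and discrete phase-type laws -/

section MarkovChain

variable {E Ω : Type*} [MeasurableSpace Ω] {ν : Measure Ω} {X : ℕ → Ω → E}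
  {init : E → ℝ} {Q : ℕ → Matrix E E ℝ}

lemma IsMarkovChain.real_zero (hX : IsMarkovChain ν X init Q) (s : E) :
    ν.real {ω | X 0 ω = s} = init s := by
  simpa using hX.2 0 fun _ => s

lemma IsMarkovChain.measurableSet_prefix (hX : IsMarkovChain ν X init Q) (n : ℕ)
    (p : Fin n → E) : MeasurableSet {ω | ∀ k, X (k : Fin n) ω = p k} := by
  rw [Set.ofPred_forall]
  exact MeasurableSet.iInter fun k => hX.1 _ _

variable [Fintype E] [IsFiniteMeasure ν]

lemma IsMarkovChain.real_eq_sum_prefix (hX : IsMarkovChain ν X init Q) (n : ℕ) {S : Set Ω}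
    (hS : MeasurableSet S) :
    ν.real S = ∑ p : Fin n → E, ν.real (S ∩ {ω | ∀ k, X (k : Fin n) ω = p k}) := by
  rw [← measureReal_biUnion_finset]
  · congr 1
    ext ω
    simp only [Finset.mem_univ, Set.iUnion_true, Set.mem_iUnion, Set.mem_inter_iff,
      Set.mem_ofPred_eq]
    exact ⟨fun h => ⟨fun k => X k ω, h, fun _ => rfl⟩, fun ⟨_, h, _⟩ => h⟩
  · intro p _ p' _ hpp
    refine Set.disjoint_left.2 fun ω h1 h2 => hpp ?_
    funext k
    exact (h1.2 k).symm.trans (h2.2 k)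
  · exact fun p _ => hS.inter (hX.measurableSet_prefix n p)

lemma IsMarkovChain.real_joint (hX : IsMarkovChain ν X init Q) (n : ℕ) (s t : E) :
    ν.real {ω | X n ω = s ∧ X (n + 1) ω = t} = ν.real {ω | X n ω = s} * Q n s t := by
  rw [hX.real_eq_sum_prefix (n + 1) (S := {ω | X n ω = s ∧ X (n + 1) ω = t})
    ((hX.1 n s).inter (hX.1 (n + 1) t)), hX.real_eq_sum_prefix (n + 1) (hX.1 n s),
    Finset.sum_mul]
  refine Finset.sum_congr rfl fun p _ => ?_
  by_cases hp : p (Fin.last n) = s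
  · set u : ℕ → E := fun k => if h : k < n + 1 then p ⟨k, h⟩ else t with hu
    have hup : ∀ k (h : k < n + 1), u k = p ⟨k, h⟩ := fun k h => dif_pos h
    have hun : u n = s := (hup n (by omega)).trans hp
    have hut : u (n + 1) = t := by simp [hu]
    have h1 : {ω | X n ω = s ∧ X (n + 1) ω = t} ∩ {ω | ∀ k : Fin (n + 1), X k ω = p k} =
        {ω | ∀ k ≤ n + 1, X k ω = u k} := by
      ext ω
      simp only [Set.mem_inter_iff, Set.mem_ofPred_eq]
      constructor
      · rintro ⟨⟨_, h2⟩, h3⟩ k hk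
        rcases hk.lt_or_eq with hk | rfl
        · rw [hup k hk]
          exact h3 ⟨k, hk⟩
        · rw [h2, hut]
      · intro h
        refine ⟨⟨by rw [h n (by omega), hun], by rw [h _ le_rfl, hut]⟩, fun k => ?_⟩
        rw [h k (by omega), hup k k.2]
    have h2 : {ω | X n ω = s} ∩ {ω | ∀ k : Fin (n + 1), X k ω = p k} =
        {ω | ∀ k ≤ n, X k ω = u k} := by
      ext ω
      simp only [Set.mem_inter_iff, Set.mem_ofPred_eq]
      constructor
      · rintro ⟨_, h3⟩ k hk
        rw [hup k (Nat.lt_succ_iff.2 hk)]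
        exact h3 ⟨k, Nat.lt_succ_iff.2 hk⟩
      · intro h
        refine ⟨by rw [h n le_rfl, hun], fun k => ?_⟩
        rw [h k (by omega), hup k k.2]
    rw [h1, h2, hX.2, hX.2, Finset.prod_range_succ, hun, hut, mul_assoc]
  · have hne : ∀ S : Set Ω, S ⊆ {ω | X n ω = s} →
        S ∩ {ω | ∀ k : Fin (n + 1), X k ω = p k} = ∅ := fun S hS => by
      ext ω
      simp only [Set.mem_inter_iff, Set.mem_ofPred_eq, Set.mem_empty_iff_false, iff_false, not_and]
      exact fun h1 h2 => hp ((h2 (Fin.last n)).symm.trans (by simpa using hS h1))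
    rw [hne _ fun ω h => h.1, hne _ fun ω h => h]
    simp

lemma IsMarkovChain.real_succ (hX : IsMarkovChain ν X init Q) (n : ℕ) (t : E) :
    ν.real {ω | X (n + 1) ω = t} = ∑ s, ν.real {ω | X n ω = s} * Q n s t := by
  simp only [← hX.real_joint]
  rw [← measureReal_biUnion_finset]
  · congr 1
    ext ω
    simp
  · intro p _ p' _ hpp
    exact Set.disjoint_left.2 fun ω h1 h2 => hpp (h1.1.symm.trans h2.1)
  · exact fun p _ => (hX.1 n p).inter (hX.1 (n + 1) t)

end MarkovChain

section PhaseType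

variable {Ω : Type*} [MeasurableSpace Ω] {P : Measure Ω} {T : Ω → ℕ} {M : ℕ}
    {β : Fin M → ℝ} {A : Matrix (Fin M) (Fin M) ℝ}

/-- The absorbing state cannot be left, so absorption happens for the first time at `n + 1` if and
only if the chain is transient at time `n` and absorbed at time `n + 1`. -/
lemma IsDPH.real_eq_succ (hT : IsDPH P T β A) (n : ℕ) :
    P.real {ω | T ω = n + 1} = ∑ m, (β ᵥ* A ^ n) m - ∑ m, (β ᵥ* A ^ (n + 1)) m := by
  obtain ⟨Ω', _, ν, Y, _, hY, hlaw⟩ := hT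
  have hu : ∀ n, (fun m => ν.real {ω | Y n ω = Sum.inl m}) = β ᵥ* A ^ n := by
    intro n
    induction n with
    | zero => funext m; rw [hY.real_zero]; simp
    | succ n ih =>
      rw [pow_succ, ← Matrix.vecMul_vecMul, ← ih]
      funext m
      rw [hY.real_succ]
      simp [absorbingMatrix, Matrix.vecMul, dotProduct]
  have habs : ∀ᵐ ω ∂ν, ∀ k, Y k ω = Sum.inr () → Y (k + 1) ω = Sum.inr () := by
    rw [ae_all_iff]
    intro k
    have h0 : ∀ᵐ ω ∂ν, ∀ m, ¬ (Y k ω = Sum.inr () ∧ Y (k + 1) ω = Sum.inl m) := by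
      rw [ae_all_iff]
      intro m
      have := hY.real_joint k (Sum.inr ()) (Sum.inl m)
      rw [show absorbingMatrix A _ (Sum.inr ()) (Sum.inl m) = 0 by simp [absorbingMatrix],
        mul_zero, measureReal_eq_zero_iff] at this
      rw [ae_iff]
      simpa using this
    filter_upwards [h0] with ω hω h
    rcases hk : Y (k + 1) ω with m | u
    · exact absurd ⟨h, hk⟩ (hω m)
    · rfl
  have hset : ν.real {ω | Y (n + 1) ω = Sum.inr () ∧ ∀ m < n + 1, Y m ω ≠ Sum.inr ()} =
      ν.real (⋃ m ∈ (Finset.univ : Finset (Fin M)),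
        {ω | Y n ω = Sum.inl m ∧ Y (n + 1) ω = Sum.inr ()}) := by
    refine measureReal_congr (eventuallyEq_set.2 ?_)
    filter_upwards [habs] with ω hω
    simp only [Finset.mem_univ, Set.iUnion_true, Set.mem_iUnion, Set.mem_ofPred_eq,
      exists_and_right]
    constructor
    · rintro ⟨h1, h2⟩
      refine ⟨?_, h1⟩
      rcases hk : Y n ω with m | u
      · exact ⟨m, rfl⟩
      · exact absurd hk (h2 n (by omega))
    · rintro ⟨⟨m, hm⟩, h1⟩
      refine ⟨h1, fun k hk hk' => ?_⟩
      have : ∀ i, Y (k + i) ω = Sum.inr () := fun i => by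
        induction i with
        | zero => exact hk'
        | succ i ih => exact hω _ ih
      have h3 := this (n - k)
      rw [Nat.add_sub_cancel' (by omega), hm] at h3
      exact absurd h3 (by simp)
  rw [measureReal_def, hlaw, ← measureReal_def, hset, measureReal_biUnion_finset]
  · simp only [hY.real_joint, pow_succ, ← Matrix.vecMul_vecMul, ← hu]
    simp only [absorbingMatrix, Matrix.fromBlocks_apply₁₂, Matrix.of_apply, absorptionVector,
      Matrix.vecMul, dotProduct]
    rw [Finset.sum_comm, ← Finset.sum_sub_distrib]
    refine Finset.sum_congr rfl fun m _ => ?_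
    rw [← Finset.mul_sum]
    ring
  · intro p _ p' _ hpp
    refine Set.disjoint_left.2 fun ω h1 h2 => hpp ?_
    simpa using h1.1.symm.trans h2.1
  · exact fun p _ => (hY.1 n _).inter (hY.1 (n + 1) _)

lemma IsDPH.real_eq_zero (hT : IsDPH P T β A) : P.real {ω | T ω = 0} = 0 := by
  obtain ⟨Ω', _, ν, Y, _, hY, hlaw⟩ := hT
  rw [measureReal_def, hlaw, ← measureReal_def]
  simpa using hY.real_zero (Sum.inr ())

/-- The tail of a discrete phase-type law. -/
lemma IsDPH.real_lt [IsProbabilityMeasure P] (hT : IsDPH P T β A) (hm : Measurable T)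
    (hβ : ∑ m, β m = 1) (n : ℕ) : P.real {ω | n < T ω} = ∑ m, (β ᵥ* A ^ n) m := by
  have hmeas : ∀ s : Set ℕ, MeasurableSet (T ⁻¹' s) := fun s =>
    hm (Set.to_countable s).measurableSet
  induction n with
  | zero =>
    have : {ω | 0 < T ω} = (T ⁻¹' {0})ᶜ := by
      ext ω
      simp [Nat.pos_iff_ne_zero]
    rw [this, probReal_compl_eq_one_sub (hmeas {0}),
      show P.real (T ⁻¹' {0}) = 0 from hT.real_eq_zero]
    simp [hβ]
  | succ n ih =>
    have : {ω | n < T ω} = {ω | T ω = n + 1} ∪ T ⁻¹' Set.Ioi (n + 1) := by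
      ext ω
      simp only [Set.mem_ofPred_eq, Set.mem_union, Set.mem_preimage, Set.mem_Ioi]
      omega
    rw [this, measureReal_union _ (hmeas (Set.Ioi (n + 1))), hT.real_eq_succ] at ih
    · change P.real (T ⁻¹' Set.Ioi (n + 1)) = _
      linarith
    · exact Set.disjoint_left.2 fun ω h1 h2 => by
        simp only [Set.mem_ofPred_eq, Set.mem_preimage, Set.mem_Ioi] at h1 h2
        omega

end PhaseType

namespace ServerSystem

variable {J : ℕ} (N : ServerSystem J)

/-! ### Regimes and the policy -/

lemma τ_mono {r r' : ℕ} (h : r ≤ r') (hr' : r' ≤ J) : N.τ r ≤ N.τ r' := by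
  induction r', h using Nat.le_induction with
  | base => exact le_rfl
  | succ k hk ih =>
    refine (ih (by omega)).trans ?_
    rcases Nat.lt_or_ge k 2 with h2 | h2
    · interval_cases k
      · rw [N.τ_zero]; exact Nat.zero_le _
      · exact N.τ_one_le_two hr'
    · exact (N.τ_lt k h2 (by omega)).le

lemma regime_eq {k r : ℕ} (hr : r ≤ J) (h1 : N.τ r ≤ k) (h2 : r < J → k < N.τ (r + 1)) :
    N.regime k = r := by
  have : (Finset.Icc 1 J).filter (fun i => N.τ i ≤ k) = Finset.Icc 1 r := by
    ext i
    simp only [Finset.mem_filter, Finset.mem_Icc]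
    constructor
    · rintro ⟨⟨h3, h4⟩, h5⟩
      refine ⟨h3, ?_⟩
      by_contra! h6
      have := h2 (by omega)
      have := N.τ_mono (show r + 1 ≤ i by omega) h4
      omega
    · rintro ⟨h3, h4⟩
      exact ⟨⟨h3, h4.trans hr⟩, (N.τ_mono h4 hr).trans h1⟩
  rw [regime, this]
  simp

lemma regime_le (k : ℕ) : N.regime k ≤ J := by
  simpa [regime] using Finset.card_filter_le (Finset.Icc 1 J) fun i => N.τ i ≤ k

lemma regime_spec (k : ℕ) :
    N.τ (N.regime k) ≤ k ∧ (N.regime k < J → k < N.τ (N.regime k + 1)) := by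
  set r := Nat.findGreatest (fun i => N.τ i ≤ k) J with hr
  have h1 : N.τ r ≤ k :=
    Nat.findGreatest_spec (P := fun i => N.τ i ≤ k) (Nat.zero_le J) (by simp [N.τ_zero])
  have h2 : r < J → k < N.τ (r + 1) := fun h => by
    by_contra! h3
    exact Nat.findGreatest_is_greatest (P := fun i => N.τ i ≤ k) (Nat.lt_succ_self r) h h3
  rw [N.regime_eq (Nat.findGreatest_le J) h1 h2]
  exact ⟨h1, h2⟩

lemma regime_mono : Monotone N.regime := fun _ _ h =>
  Finset.card_le_card (Finset.monotone_filter_right _ fun _ _ hi => hi.trans h)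

lemma decide_of_lt (k : ℕ) {a : ℕ} (h : a < N.τ 1) : N.decide k a = none := by
  rw [decide, select, dif_neg]
  · rfl
  · rintro ⟨j, h1 | h1⟩
    · have := N.τ_mono (show 1 ≤ (j : ℕ) + 1 by omega) j.2
      omega
    · omega

lemma path_before (σ : Fin J → ℕ → ℕ) (a₀ : ℕ) {k : ℕ} (h : k < N.τ 1 - a₀) :
    N.path σ a₀ k = ⟨a₀ + k, none⟩ := by
  induction k with
  | zero => rw [path, N.decide_of_lt _ (by omega)]; rfl
  | succ k ih =>
    rw [path, ih (by omega), step]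
    simp only
    rw [N.decide_of_lt _ (by omega)]
    rfl

variable [NeZero J]

lemma regime_eq_zero_iff {k : ℕ} : N.regime k = 0 ↔ k < N.τ 1 := by
  constructor
  · intro h
    have := (N.regime_spec k).2
    rw [h] at this
    exact this (Nat.pos_of_ne_zero (NeZero.ne J))
  · exact fun h => N.regime_eq (Nat.zero_le J) (by simp [N.τ_zero]) fun _ => h

/-- The server used for the packet that follows a packet with service time `v`, hence started at
age `max v τ₁`. -/
def server (v : ℕ) : Fin J := Fin.ofNat J (N.regime (v - 1) - 1)

lemma server_val (v : ℕ) : (N.server v : ℕ) = N.regime (v - 1) - 1 := by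
  have := N.regime_le (v - 1)
  have := Nat.pos_of_ne_zero (NeZero.ne J)
  simp only [server, Fin.ofNat]
  exact Nat.mod_eq_of_lt (by omega)

lemma server_eq_of_le {v w : ℕ} (hv : v ≤ N.τ 1) (hw : w ≤ N.τ 1) : N.server v = N.server w := by
  have := N.τ_one_pos
  rw [server, server, N.regime_eq_zero_iff.2 (by omega), N.regime_eq_zero_iff.2 (by omega)]

lemma eq_server_of_uses {j : Fin J} {a : ℕ} (h : N.Uses j a) : j = N.server a := by
  apply Fin.ext
  rw [server_val]
  have := N.τ_one_pos
  rcases h with ⟨h1, h2⟩ | ⟨h1, h2⟩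
  · rw [N.regime_eq (r := j + 1) j.2 (by omega) fun h => by
      have : a ≤ N.τ (j + 1 + 1) := h2 h
      omega]
    rfl
  · rw [h1, N.regime_eq_zero_iff.2 (by omega)]

lemma uses_server {a : ℕ} (h : N.τ 1 ≤ a) : N.Uses (N.server a) a := by
  have hp := N.τ_one_pos
  rcases h.eq_or_lt with h | h
  · right
    rw [server_val, N.regime_eq_zero_iff.2 (by omega)]
    exact ⟨rfl, h.symm⟩
  · left
    have h0 : N.regime (a - 1) ≠ 0 := fun h0 => by
      rw [N.regime_eq_zero_iff] at h0
      omega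
    obtain ⟨h1, h2⟩ := N.regime_spec (a - 1)
    rw [server_val, show N.regime (a - 1) - 1 + 1 = N.regime (a - 1) by omega,
      show N.regime (a - 1) - 1 + 2 = N.regime (a - 1) + 1 by omega]
    exact ⟨by omega, fun h => by have := h2 h; omega⟩

lemma decide_of_le (k : ℕ) {a : ℕ} (h : N.τ 1 ≤ a) : N.decide k a = some (N.server a, k) := by
  have hex : ∃ j, N.Uses j a := ⟨_, N.uses_server h⟩
  rw [decide, select, dif_pos hex, N.eq_server_of_uses hex.choose_spec]
  rfl

/-! ### Successive packets -/

section Packets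

variable (σ : Fin J → ℕ → ℕ) (a₀ : ℕ)

/-- Generation slot and server of the next packet, when the last one was generated in slot `p.1` and
had service time `v`. -/
def nextPacket (p : ℕ × Fin J) (v : ℕ) : ℕ × Fin J := (p.1 + max v (N.τ 1), N.server v)

/-- Generation slots and servers of the successive packets. The source generates the first one in
slot `τ₁ - a₀`, which is slot `0` if the initial age is at least `τ₁`. -/
def packet : ℕ → ℕ × Fin J
  | 0 => (N.τ 1 - a₀, N.server a₀)
  | i + 1 => N.nextPacket (packet i) (σ (packet i).2 (packet i).1)

/-- Service times of the successive packets. -/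
def service (i : ℕ) : ℕ := σ (N.packet σ a₀ i).2 (N.packet σ a₀ i).1

/-- Slots of reception of the successive packets. In the formulas for these slots, service times are
positive, as they are almost surely. -/
def reception (i : ℕ) : ℕ := (N.packet σ a₀ i).1 + N.service σ a₀ i

/-- Age at the generation of the successive packets. -/
def genAge : ℕ → ℕ
  | 0 => max a₀ (N.τ 1)
  | i + 1 => max (N.service σ a₀ i) (N.τ 1)

lemma packet_succ_fst (i : ℕ) :
    (N.packet σ a₀ (i + 1)).1 = (N.packet σ a₀ i).1 + max (N.service σ a₀ i) (N.τ 1) := rfl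

lemma packet_succ_snd (i : ℕ) : (N.packet σ a₀ (i + 1)).2 = N.server (N.service σ a₀ i) := rfl

lemma path_packet_zero :
    N.path σ a₀ (N.packet σ a₀ 0).1 =
      ⟨N.genAge σ a₀ 0, some ((N.packet σ a₀ 0).2, (N.packet σ a₀ 0).1)⟩ := by
  simp only [packet, genAge]
  rcases le_or_gt (N.τ 1) a₀ with h | h
  · rw [Nat.sub_eq_zero_of_le h, max_eq_left h, path, N.decide_of_le _ h]
  · obtain ⟨k, hk⟩ : ∃ k, N.τ 1 - a₀ = k + 1 := ⟨N.τ 1 - a₀ - 1, by omega⟩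
    rw [hk, path, N.path_before σ a₀ (by omega), step, max_eq_right h.le]
    simp only
    rw [show a₀ + k + 1 = N.τ 1 by omega, N.decide_of_le _ le_rfl,
      N.server_eq_of_le le_rfl h.le]

variable {σ}

lemma path_transmission {i : ℕ}
    (h : N.path σ a₀ (N.packet σ a₀ i).1 =
      ⟨N.genAge σ a₀ i, some ((N.packet σ a₀ i).2, (N.packet σ a₀ i).1)⟩)
    {m : ℕ} (hm : m < N.service σ a₀ i) :
    N.path σ a₀ ((N.packet σ a₀ i).1 + m) =
      ⟨N.genAge σ a₀ i + m, some ((N.packet σ a₀ i).2, (N.packet σ a₀ i).1)⟩ := by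
  induction m with
  | zero => exact h
  | succ m ih =>
    rw [← Nat.add_assoc, path, ih (by omega), step]
    simp only
    rw [if_neg]
    · rfl
    · change ¬ (N.packet σ a₀ i).1 + m + 1 = (N.packet σ a₀ i).1 + N.service σ a₀ i
      omega

lemma path_reception (hσ : ∀ j g, 0 < σ j g) {i : ℕ}
    (h : N.path σ a₀ (N.packet σ a₀ i).1 =
      ⟨N.genAge σ a₀ i, some ((N.packet σ a₀ i).2, (N.packet σ a₀ i).1)⟩) :
    N.path σ a₀ (N.reception σ a₀ i) =
      ⟨N.service σ a₀ i, N.decide (N.reception σ a₀ i) (N.service σ a₀ i)⟩ := by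
  have hpos : 0 < N.service σ a₀ i := hσ _ _
  obtain ⟨m, hm⟩ : ∃ m, N.service σ a₀ i = m + 1 := ⟨_, (Nat.succ_pred_eq_of_pos hpos).symm⟩
  have hr : N.reception σ a₀ i = (N.packet σ a₀ i).1 + m + 1 := by
    rw [reception, hm]; rfl
  rw [hr, path, N.path_transmission a₀ h (show m < _ by omega), step]
  simp only
  change (if (N.packet σ a₀ i).1 + m + 1 = (N.packet σ a₀ i).1 + N.service σ a₀ i then _ else _) = _
  rw [if_pos (by omega), show (N.packet σ a₀ i).1 + m + 1 - (N.packet σ a₀ i).1 =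
    N.service σ a₀ i by omega]

lemma path_idle (hσ : ∀ j g, 0 < σ j g) {i : ℕ}
    (h : N.path σ a₀ (N.packet σ a₀ i).1 =
      ⟨N.genAge σ a₀ i, some ((N.packet σ a₀ i).2, (N.packet σ a₀ i).1)⟩)
    {m : ℕ} (hm : N.service σ a₀ i + m < N.τ 1) :
    N.path σ a₀ (N.reception σ a₀ i + m) = ⟨N.service σ a₀ i + m, none⟩ := by
  induction m with
  | zero =>
    rw [Nat.add_zero, N.path_reception a₀ hσ h, N.decide_of_lt _ (by omega)]
    rfl
  | succ m ih =>
    rw [← Nat.add_assoc, path, ih (by omega), step]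
    simp only
    rw [N.decide_of_lt _ (by omega)]
    rfl

lemma path_packet (hσ : ∀ j g, 0 < σ j g) (i : ℕ) :
    N.path σ a₀ (N.packet σ a₀ i).1 =
      ⟨N.genAge σ a₀ i, some ((N.packet σ a₀ i).2, (N.packet σ a₀ i).1)⟩ := by
  induction i with
  | zero => exact N.path_packet_zero σ a₀
  | succ i ih =>
    rw [packet_succ_fst, packet_succ_snd, genAge]
    rcases le_or_gt (N.τ 1) (N.service σ a₀ i) with h | h
    · rw [max_eq_left h]
      change N.path σ a₀ (N.reception σ a₀ i) = ⟨_, some (_, N.reception σ a₀ i)⟩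
      rw [N.path_reception a₀ hσ ih, N.decide_of_le _ h]
    · obtain ⟨m, hm⟩ : ∃ m, N.τ 1 = N.service σ a₀ i + m + 1 :=
        ⟨N.τ 1 - N.service σ a₀ i - 1, by omega⟩
      rw [max_eq_right h.le, show (N.packet σ a₀ i).1 + N.τ 1 = N.reception σ a₀ i + m + 1 by
        rw [reception]; omega, path, N.path_idle a₀ hσ ih (by omega), step]
      simp only
      rw [← hm, N.decide_of_le _ le_rfl, N.server_eq_of_le le_rfl h.le]

/-- Between the receptions of the packets `i` and `i + 1` the link is idle until the generation of
packet `i + 1`, and busy with it afterwards. -/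
lemma sum_cycle (hσ : ∀ j g, 0 < σ j g) {M : Type*} [AddCommMonoid M] (F : ℕ → LinkState J → M)
    (i : ℕ) :
    ∑ k ∈ Finset.Ico (N.reception σ a₀ i) (N.reception σ a₀ (i + 1)), F k (N.path σ a₀ k) =
      ∑ k ∈ Finset.Ico (N.reception σ a₀ i) (N.packet σ a₀ (i + 1)).1,
        F k ⟨k - (N.packet σ a₀ i).1, none⟩ +
      ∑ m ∈ Finset.range (N.service σ a₀ (i + 1)), F ((N.packet σ a₀ (i + 1)).1 + m)
        ⟨max (N.service σ a₀ i) (N.τ 1) + m,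
          some ((N.packet σ a₀ (i + 1)).2, (N.packet σ a₀ (i + 1)).1)⟩ := by
  have h1 : N.reception σ a₀ i ≤ (N.packet σ a₀ (i + 1)).1 := by
    rw [reception, packet_succ_fst]
    have := le_max_left (N.service σ a₀ i) (N.τ 1)
    omega
  have h2 : (N.packet σ a₀ (i + 1)).1 ≤ N.reception σ a₀ (i + 1) := Nat.le_add_right _ _
  rw [← Finset.sum_Ico_consecutive _ h1 h2]
  congr 1
  · refine Finset.sum_congr rfl fun k hk => ?_
    rw [Finset.mem_Ico, packet_succ_fst] at hk
    obtain ⟨m, rfl⟩ := Nat.exists_eq_add_of_le hk.1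
    have hm : N.service σ a₀ i + m < N.τ 1 := by
      rw [reception] at hk
      rcases max_cases (N.service σ a₀ i) (N.τ 1) with h | h <;> omega
    rw [N.path_idle a₀ hσ (N.path_packet a₀ hσ i) hm, reception,
      show (N.packet σ a₀ i).1 + N.service σ a₀ i + m - (N.packet σ a₀ i).1 =
        N.service σ a₀ i + m by omega]
  · rw [Finset.sum_Ico_eq_sum_range, reception, Nat.add_sub_cancel_left]
    refine Finset.sum_congr rfl fun m hm => ?_
    rw [N.path_transmission a₀ (N.path_packet a₀ hσ (i + 1)) (Finset.mem_range.1 hm)]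
    rfl

/-- The source waits if and only if the age is below the first threshold. -/
lemma ongoing_eq_none_iff (k : ℕ) :
    (N.path σ a₀ k).ongoing = none ↔ (N.path σ a₀ k).age < N.τ 1 := by
  have hdec : ∀ k a, N.decide k a = none ↔ a < N.τ 1 := fun k a => by
    rcases lt_or_ge a (N.τ 1) with h | h
    · simp [N.decide_of_lt k h, h]
    · simp [N.decide_of_le k h, h]
  induction k with
  | zero => exact hdec 0 a₀
  | succ k ih =>
    rw [path, step]
    split
    · exact hdec _ _
    · rename_i j g hs
      split_ifs
      · exact hdec _ _
      · rw [hs] at ih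
        simp only [reduceCtorEq, false_iff] at ih ⊢
        omega

end Packets

end ServerSystem

/-! ### The transient law of the multi-regime chain -/

lemma vecMul_blockDiagonal'_apply {o : Type*} [Fintype o] [DecidableEq o] {m : o → Type*}
    [∀ i, Fintype (m i)] (D : ∀ i, Matrix (m i) (m i) ℝ) (v : (Σ i, m i) → ℝ) (j : o) (k : m j) :
    (v ᵥ* Matrix.blockDiagonal' D) ⟨j, k⟩ = ((fun k' => v ⟨j, k'⟩) ᵥ* D j) k := by
  simp only [Matrix.vecMul, dotProduct, Fintype.sum_sigma]
  rw [Finset.sum_eq_single j]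
  · simp
  · intro i _ hi
    exact Finset.sum_eq_zero fun k' _ => by rw [Matrix.blockDiagonal'_apply_ne _ _ _ hi, mul_zero]
  · simp

lemma sum_blockDiagonal'_apply {o : Type*} [Fintype o] [DecidableEq o] {m : o → Type*}
    [∀ i, Fintype (m i)] (D : ∀ i, Matrix (m i) (m i) ℝ) (j : o) (k : m j) :
    ∑ t, Matrix.blockDiagonal' D ⟨j, k⟩ t = ∑ k', D j k k' := by
  rw [Fintype.sum_sigma, Finset.sum_eq_single j]
  · simp
  · intro i _ hi
    exact Finset.sum_eq_zero fun k' _ => Matrix.blockDiagonal'_apply_ne _ _ _ hi.symm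
  · simp

namespace ServerSystem

variable {J : ℕ} (N : ServerSystem J)

lemma d_nonneg (j : Fin J) (m : Fin (N.order j)) : 0 ≤ N.d j m :=
  sub_nonneg.2 (N.D_sum_le j m)

/-- Phase probabilities of a service on server `j` after `n` slots. -/
def phaseVec (j : Fin J) (n : ℕ) : Fin (N.order j) → ℝ := N.α j ᵥ* N.D j ^ n

/-- The probability that a service on server `j` takes more than `n` slots. -/
def tail (j : Fin J) (n : ℕ) : ℝ := ∑ m, N.phaseVec j n m

/-- The probability that a service on server `j` takes `s` slots; it vanishes at `s = 0` because of
`0 - 1 = 0`. -/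
def prob (j : Fin J) (s : ℕ) : ℝ := N.tail j (s - 1) - N.tail j s

lemma phaseVec_zero (j : Fin J) : N.phaseVec j 0 = N.α j := by simp [phaseVec]

lemma phaseVec_succ (j : Fin J) (n : ℕ) : N.phaseVec j (n + 1) = N.phaseVec j n ᵥ* N.D j := by
  rw [phaseVec, phaseVec, pow_succ, Matrix.vecMul_vecMul]

lemma tail_zero (j : Fin J) : N.tail j 0 = 1 := by rw [tail, phaseVec_zero, N.α_sum]

lemma prob_zero (j : Fin J) : N.prob j 0 = 0 := sub_self _

lemma dotProduct_d (j : Fin J) (v : Fin (N.order j) → ℝ) :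
    v ⬝ᵥ N.d j = ∑ m, v m - ∑ m, (v ᵥ* N.D j) m := by
  simp only [d, absorptionVector, Matrix.vecMul, dotProduct]
  rw [Finset.sum_comm, ← Finset.sum_sub_distrib]
  refine Finset.sum_congr rfl fun m _ => ?_
  rw [← Finset.mul_sum]
  ring

lemma phaseVec_dotProduct_d (j : Fin J) (n : ℕ) :
    N.phaseVec j n ⬝ᵥ N.d j = N.prob j (n + 1) := by
  rw [dotProduct_d, ← phaseVec_succ]
  rfl

lemma hasSum_tail (j : Fin J) :
    HasSum (N.tail j) ((N.α j ᵥ* (1 - N.D j)⁻¹) ⬝ᵥ 1) := by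
  have := hasSum_vecMul_pow_dotProduct (N.D_nonneg j) (N.D_sum_le j) (N.D_fundamental j)
    (N.α j) 1
  refine this.congr_fun fun n => ?_
  simp [tail, phaseVec, dotProduct]

/-- The law on the transient states at time `n`, when the server of the first packet has law `κ`. -/
def flow (κ : Fin J → ℝ) : ℕ → N.Transient → ℝ
  | 0 => N.β κ 0
  | n + 1 => flow κ n ᵥ* N.A (N.regime n)

variable (κ : Fin J → ℝ)

lemma flow_zero_inl (j : Fin J) (m : Fin (N.order j)) :
    N.flow κ 0 (Sum.inl ⟨j, m⟩) = κ j * N.α j m := by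
  simp [flow, β, initMatrix, Matrix.vecMul, dotProduct]

lemma flow_zero_inr (t : N.Phase) : N.flow κ 0 (Sum.inr t) = 0 := by
  simp [flow, β, initMatrix, Matrix.vecMul, dotProduct]

/-- States `(1, j, m)`: the first packet is in service on server `j`. -/
lemma flow_inl (n : ℕ) (j : Fin J) (m : Fin (N.order j)) :
    N.flow κ n (Sum.inl ⟨j, m⟩) = κ j * N.phaseVec j n m := by
  induction n generalizing m with
  | zero => rw [flow_zero_inl, phaseVec_zero]
  | succ n ih =>
    rw [flow, A, Matrix.vecMul_fromBlocks, Sum.elim_inl, Pi.add_apply,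
      vecMul_blockDiagonal'_apply, Matrix.vecMul_zero, phaseVec_succ]
    simp only [Function.comp_apply, ih, Matrix.vecMul, dotProduct, Pi.zero_apply, add_zero,
      Finset.mul_sum, mul_assoc]

lemma flow_succ_inr [NeZero J] (n : ℕ) (j : Fin J) (m : Fin (N.order j)) :
    N.flow κ (n + 1) (Sum.inr ⟨j, m⟩) =
      (if N.server (n + 1) = j then (∑ l, κ l * N.prob l (n + 1)) * N.α j m else 0) +
      ((fun m' => N.flow κ n (Sum.inr ⟨j, m'⟩)) ᵥ*
        (if (j : ℕ) < N.regime n then N.D j else 1)) m := by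
  rw [flow, A, Matrix.vecMul_fromBlocks, Sum.elim_inr, Pi.add_apply, vecMul_blockDiagonal'_apply]
  congr 1
  have hiff : N.server (n + 1) = j ↔ (j : ℕ) = N.regime n - 1 := by
    rw [Fin.ext_iff, server_val, Nat.add_sub_cancel]
    exact eq_comm
  simp only [Matrix.vecMul, dotProduct, Matrix.of_apply, Function.comp_apply, hiff,
    Fintype.sum_sigma, flow_inl]
  split_ifs with h
  · rw [Finset.sum_mul]
    refine Finset.sum_congr rfl fun l _ => ?_
    rw [← phaseVec_dotProduct_d, dotProduct, Finset.mul_sum, Finset.sum_mul]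
    exact Finset.sum_congr rfl fun _ _ => by ring
  · simp

/-- States `(2, j, m)`: the first packet had service time `s ≤ n`, and the second one, started at
age `max s τ₁` on server `j`, is still in service. -/
lemma flow_inr [NeZero J] (n : ℕ) (j : Fin J) (m : Fin (N.order j)) :
    N.flow κ n (Sum.inr ⟨j, m⟩) = ∑ s ∈ Finset.range (n + 1),
      if N.server s = j then
        (∑ l, κ l * N.prob l s) * N.phaseVec j (n - max s (N.τ 1)) m else 0 := by
  induction n generalizing m with
  | zero => simp [flow_zero_inr, prob_zero]
  | succ n ih =>
    rw [flow_succ_inr, Finset.sum_range_succ, add_comm, Nat.sub_eq_zero_of_le (le_max_left _ _),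
      phaseVec_zero]
    congr 1
    rw [show (fun m' => N.flow κ n (Sum.inr ⟨j, m'⟩)) = ∑ s ∈ Finset.range (n + 1),
      if N.server s = j then
        (∑ l, κ l * N.prob l s) • N.phaseVec j (n - max s (N.τ 1)) else 0 by
        funext m'
        rw [ih, Finset.sum_apply]
        refine Finset.sum_congr rfl fun s _ => ?_
        split_ifs <;> rfl, Matrix.sum_vecMul, Finset.sum_apply]
    refine Finset.sum_congr rfl fun s hs => ?_
    rw [Finset.mem_range] at hs
    have h1 := N.τ_one_pos
    -- The states `(2, j, ·)` are frozen while the second packet waits, before time `τ₁`. From then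
    -- on, the server chosen after a service time `s ≤ n` is below the regime of `n`.
    split_ifs with h2 h3 h3
    · have h4 : N.τ 1 ≤ n := by
        by_contra! h4
        rw [N.regime_eq_zero_iff.2 h4] at h3
        omega
      rw [Matrix.smul_vecMul, ← phaseVec_succ, Pi.smul_apply, smul_eq_mul,
        show n + 1 - max s (N.τ 1) = n - max s (N.τ 1) + 1 by omega]
    · have h4 : n < N.τ 1 := by
        by_contra! h4
        have h5 : N.regime n ≠ 0 := fun h => by
          rw [N.regime_eq_zero_iff] at h
          omega
        have h6 := N.regime_mono (show s - 1 ≤ n by omega)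
        rw [← h2, server_val] at h3
        omega
      rw [Matrix.vecMul_one, Pi.smul_apply, smul_eq_mul,
        show n + 1 - max s (N.τ 1) = n - max s (N.τ 1) by omega]
    all_goals simp

/-- The probability that the chain is in `C` at time `n`, as a sum over the service time of the
first packet. -/
lemma flow_dotProduct_h [NeZero J] (n : ℕ) : N.flow κ n ⬝ᵥ N.h =
    ∑ s ∈ Finset.range (n + 1), (∑ l, κ l * N.prob l s) *
      N.tail (N.server s) (n - max s (N.τ 1)) := by
  simp only [dotProduct, h, Fintype.sum_sum_type, Sum.elim_inl, Sum.elim_inr, mul_zero, mul_one,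
    Finset.sum_const_zero, zero_add, Fintype.sum_sigma, flow_inr]
  have : ∀ j : Fin J, (∑ m, ∑ s ∈ Finset.range (n + 1), if N.server s = j then
      (∑ l, κ l * N.prob l s) * N.phaseVec j (n - max s (N.τ 1)) m else 0) =
      ∑ s ∈ Finset.range (n + 1), if N.server s = j then
        (∑ l, κ l * N.prob l s) * N.tail j (n - max s (N.τ 1)) else 0 := fun j => by
    rw [Finset.sum_comm]
    refine Finset.sum_congr rfl fun s _ => ?_
    split_ifs
    · rw [tail, Finset.mul_sum]
    · simp
  simp only [this]
  rw [Finset.sum_comm]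
  exact Finset.sum_congr rfl fun s _ => by rw [Finset.sum_ite_eq]; simp

/-! ### Series over the regimes -/

lemma flow_eq_of_flow_τ {r : ℕ} (hr : r ≤ J) (hβ : N.β κ r = N.flow κ (N.τ r)) (m : ℕ)
    (hm : r < J → N.τ r + m ≤ N.τ (r + 1)) :
    N.flow κ (N.τ r + m) = N.β κ r ᵥ* N.A r ^ m := by
  induction m with
  | zero => simp [hβ]
  | succ m ih =>
    rw [← Nat.add_assoc, flow, ih fun h => by have := hm h; omega,
      N.regime_eq hr (Nat.le_add_right _ _) fun h => by have := hm h; omega,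
      Matrix.vecMul_vecMul, ← pow_succ]

lemma β_eq_flow {r : ℕ} (hr : r ≤ J) : N.β κ r = N.flow κ (N.τ r) := by
  induction r with
  | zero => rw [N.τ_zero]; rfl
  | succ r ih =>
    have h1 := N.τ_mono (Nat.le_succ r) hr
    have h2 : N.τ r + N.δ r = N.τ (r + 1) := Nat.add_sub_cancel' h1
    rw [β, ← N.flow_eq_of_flow_τ κ (by omega) (ih (by omega)) _ fun _ => h2.le, h2]

lemma flow_eq {n r : ℕ} (hr : r ≤ J) (h1 : N.τ r ≤ n) (h2 : r < J → n < N.τ (r + 1)) :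
    N.flow κ n = N.β κ r ᵥ* N.A r ^ (n - N.τ r) := by
  obtain ⟨m, rfl⟩ := Nat.exists_eq_add_of_le h1
  rw [N.flow_eq_of_flow_τ κ hr (N.β_eq_flow κ hr) m fun h => (h2 h).le, Nat.add_sub_cancel_left]

lemma A_nonneg (r : ℕ) (s t : N.Transient) : 0 ≤ N.A r s t := by
  have hb : ∀ (D : (j : Fin J) → Matrix (Fin (N.order j)) (Fin (N.order j)) ℝ),
      (∀ j m m', 0 ≤ D j m m') → ∀ s t, 0 ≤ Matrix.blockDiagonal' D s t := by
    rintro D hD ⟨j, m⟩ ⟨j', m'⟩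
    rw [Matrix.blockDiagonal'_apply]
    split_ifs
    · exact hD _ _ _
    · exact le_rfl
  rcases s with s | s <;> rcases t with t | t
  · exact hb _ N.D_nonneg s t
  · simp only [A, Matrix.fromBlocks_apply₁₂, Matrix.of_apply]
    split_ifs
    · exact mul_nonneg (N.d_nonneg _ _) (N.α_nonneg _ _)
    · exact le_rfl
  · exact le_rfl
  · refine hb (fun j => if (j : ℕ) < r then N.D j else 1) (fun j m m' => ?_) s t
    split_ifs
    · exact N.D_nonneg _ _ _
    · rw [Matrix.one_apply]
      split_ifs <;> norm_num

lemma A_sum_le (s : N.Transient) : ∑ t, N.A J s t ≤ 1 := by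
  rcases s with ⟨j, m⟩ | ⟨j, m⟩
  · simp only [A, Fintype.sum_sum_type, Matrix.fromBlocks_apply₁₁, Matrix.fromBlocks_apply₁₂,
      sum_blockDiagonal'_apply, Matrix.of_apply]
    rw [Fintype.sum_sigma]
    have h1 : ∀ i : Fin J, (∑ m', if (i : ℕ) = J - 1 then N.d j m * N.α i m' else 0) =
        if (i : ℕ) = J - 1 then N.d j m else 0 := fun i => by
      split_ifs
      · rw [← Finset.mul_sum, N.α_sum, mul_one]
      · simp
    rw [Finset.sum_congr rfl fun i _ => h1 i]
    have h2 : ∑ i : Fin J, (if (i : ℕ) = J - 1 then N.d j m else 0) = N.d j m := by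
      have hlt : J - 1 < J := by have := j.2; omega
      rw [Finset.sum_eq_single (⟨J - 1, hlt⟩ : Fin J)]
      · simp
      · intro i _ hi
        exact if_neg fun h => hi (Fin.ext h)
      · simp
    rw [h2, d, absorptionVector]
    linarith
  · simp only [A, Fintype.sum_sum_type, Matrix.fromBlocks_apply₂₁, Matrix.fromBlocks_apply₂₂,
      sum_blockDiagonal'_apply, Matrix.zero_apply, Finset.sum_const_zero, zero_add, j.2, if_true]
    exact N.D_sum_le j m

lemma isUnit_one_sub_A : IsUnit (1 - N.A J) := by
  have hbd : IsUnit (1 - Matrix.blockDiagonal' N.D) := by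
    rw [← Matrix.blockDiagonal'_one, ← Matrix.blockDiagonal'_sub]
    exact (Pi.isUnit_iff.2 N.D_fundamental : IsUnit (1 - N.D)).map
      (Matrix.blockDiagonal'RingHom (fun j => Fin (N.order j)) ℝ)
  have hD : (fun j : Fin J => if (j : ℕ) < J then N.D j else 1) = N.D := by
    funext j
    rw [if_pos j.2]
  rw [A, ← Matrix.fromBlocks_one, sub_eq_add_neg, Matrix.fromBlocks_neg,
    Matrix.fromBlocks_add, hD, neg_zero, add_zero, ← sub_eq_add_neg,
    Matrix.isUnit_fromBlocks_zero₂₁]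
  exact ⟨hbd, hbd⟩

lemma sum_range_τ (f : ℕ → ℝ) {r : ℕ} (hr : r ≤ J) :
    ∑ n ∈ Finset.range (N.τ r), f n =
      ∑ i ∈ Finset.range r, ∑ n ∈ Finset.Ico (N.τ i) (N.τ (i + 1)), f n := by
  induction r with
  | zero => simp [N.τ_zero]
  | succ r ih =>
    rw [Finset.sum_range_succ, ← ih (by omega),
      Finset.sum_range_add_sum_Ico _ (N.τ_mono (Nat.le_succ r) hr)]

lemma hasSum_flow_tail (b : N.Transient → ℝ) :
    HasSum (fun m => N.flow κ (m + N.τ J) ⬝ᵥ b) ((N.β κ J ᵥ* (1 - N.A J)⁻¹) ⬝ᵥ b) := by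
  refine (hasSum_vecMul_pow_dotProduct (N.A_nonneg J) N.A_sum_le N.isUnit_one_sub_A
    (N.β κ J) b).congr_fun fun m => ?_
  rw [N.flow_eq κ le_rfl (Nat.le_add_left _ _) fun h => absurd h (lt_irrefl _),
    Nat.add_sub_cancel]

/-- The series of a functional of the chain that depends on the regime. -/
lemma hasSum_flow (b : ℕ → N.Transient → ℝ) :
    HasSum (fun n => N.flow κ n ⬝ᵥ b (N.regime n))
      ((N.β κ J ᵥ* (1 - N.A J)⁻¹) ⬝ᵥ b J +
        ∑ r ∈ Finset.range J, ∑ m ∈ Finset.Ico (N.τ r) (N.τ (r + 1)),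
          (N.β κ r ᵥ* N.A r ^ (m - N.τ r)) ⬝ᵥ b r) := by
  have hsum : ∑ n ∈ Finset.range (N.τ J), N.flow κ n ⬝ᵥ b (N.regime n) =
      ∑ r ∈ Finset.range J, ∑ m ∈ Finset.Ico (N.τ r) (N.τ (r + 1)),
          (N.β κ r ᵥ* N.A r ^ (m - N.τ r)) ⬝ᵥ b r := by
    rw [N.sum_range_τ _ le_rfl]
    refine Finset.sum_congr rfl fun r hr => Finset.sum_congr rfl fun m hm => ?_
    rw [Finset.mem_range] at hr
    rw [Finset.mem_Ico] at hm
    rw [N.regime_eq hr.le hm.1 fun _ => hm.2, N.flow_eq κ hr.le hm.1 fun _ => hm.2]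
  rw [← hasSum_nat_add_iff' (N.τ J), hsum, add_sub_cancel_right]
  refine (N.hasSum_flow_tail κ (b J)).congr_fun fun m => ?_
  rw [N.regime_eq le_rfl (Nat.le_add_left _ _) fun h => absurd h (lt_irrefl _)]

lemma hasSum_flow_h : HasSum (fun n => N.flow κ n ⬝ᵥ N.h) (N.meanCycle κ) :=
  N.hasSum_flow κ fun _ => N.h

lemma tendsto_flow_zero (t : N.Transient) : Tendsto (fun n => N.flow κ n t) atTop (𝓝 0) := by
  rw [← tendsto_add_atTop_iff_nat (N.τ J)]
  refine (tendsto_vecMul_pow_zero (N.A_nonneg J) N.A_sum_le N.isUnit_one_sub_A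
    (N.β κ J) t).congr fun m => ?_
  rw [N.flow_eq κ le_rfl (Nat.le_add_left _ _) fun h => absurd h (lt_irrefl _),
    Nat.add_sub_cancel]

lemma β_zero_vecMul_regimeProd (r : ℕ) : N.β κ 0 ᵥ* N.regimeProd r = N.β κ r := by
  induction r with
  | zero => rw [regimeProd, Matrix.vecMul_one]
  | succ r ih => rw [regimeProd, ← Matrix.vecMul_vecMul, ih, β]

lemma β_zero_vecMul_Ψ (j : Fin J) : (N.β κ 0 ᵥ* N.Ψ) j =
    (N.β κ J ᵥ* (1 - N.A J)⁻¹) ⬝ᵥ (fun s => N.B J s j) +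
      ∑ r ∈ Finset.range J, ∑ m ∈ Finset.Ico (N.τ r) (N.τ (r + 1)),
        (N.β κ r ᵥ* N.A r ^ (m - N.τ r)) ⬝ᵥ fun s => N.B r s j := by
  rw [Ψ, Matrix.vecMul_add, Pi.add_apply, add_comm, Matrix.vecMul_sum, Finset.sum_apply]
  congr 1
  · rw [← Matrix.vecMul_vecMul, ← Matrix.vecMul_vecMul, β_zero_vecMul_regimeProd]
    rfl
  · refine Finset.sum_congr rfl fun r _ => ?_
    rw [← Matrix.vecMul_vecMul, ← Matrix.vecMul_vecMul, β_zero_vecMul_regimeProd,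
      Matrix.vecMul_sum, Matrix.sum_vecMul, Finset.sum_apply, Finset.sum_Ico_eq_sum_range, δ]
    refine Finset.sum_congr rfl fun m _ => ?_
    rw [Nat.add_sub_cancel_left]
    rfl

/-- Conservation of the probability of the states `(2, j, ·)`: what enters them is eventually
absorbed in `j`. Hence `serverMatrix` gives the law of the server of the next packet. -/
lemma tendsto_sum_prob [NeZero J] (j : Fin J) :
    Tendsto (fun K => ∑ n ∈ Finset.range K,
      if N.server (n + 1) = j then ∑ l, κ l * N.prob l (n + 1) else 0) atTop
      (𝓝 ((κ ᵥ* N.serverMatrix) j)) := by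
  have hout := (N.hasSum_flow κ fun r s => N.B r s j).tendsto_sum_nat
  rw [← N.β_zero_vecMul_Ψ] at hout
  have hmass : Tendsto (fun n => ∑ m, N.flow κ n (Sum.inr ⟨j, m⟩)) atTop (𝓝 0) := by
    rw [show (0 : ℝ) = ∑ _m : Fin (N.order j), 0 by simp]
    exact tendsto_finsetSum _ fun m _ => N.tendsto_flow_zero κ _
  have hflow : ∀ n, N.flow κ n ⬝ᵥ (fun s => N.B (N.regime n) s j) =
      if (j : ℕ) < N.regime n then
        (fun m => N.flow κ n (Sum.inr ⟨j, m⟩)) ⬝ᵥ N.d j else 0 := fun n => by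
    simp only [dotProduct, B, Matrix.of_apply, Fintype.sum_sum_type, Sum.elim_inl, Sum.elim_inr,
      mul_zero, Finset.sum_const_zero, zero_add, Fintype.sum_sigma]
    rw [Finset.sum_eq_single j]
    · by_cases h : (j : ℕ) < N.regime n <;> simp [h]
    · intro i _ hi
      simp [hi]
    · simp
  have hbal : ∀ n, (∑ m, N.flow κ (n + 1) (Sum.inr ⟨j, m⟩)) =
      (if N.server (n + 1) = j then ∑ l, κ l * N.prob l (n + 1) else 0) +
      ((∑ m, N.flow κ n (Sum.inr ⟨j, m⟩)) -
        N.flow κ n ⬝ᵥ (fun s => N.B (N.regime n) s j)) := fun n => by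
    simp only [flow_succ_inr, Finset.sum_add_distrib]
    congr 1
    · split_ifs
      · rw [← Finset.mul_sum, N.α_sum, mul_one]
      · simp
    · rw [hflow]
      split_ifs
      · rw [dotProduct_d]
        ring
      · simp
  have hsum : ∀ K, (∑ n ∈ Finset.range K,
      if N.server (n + 1) = j then ∑ l, κ l * N.prob l (n + 1) else 0) =
      (∑ m, N.flow κ K (Sum.inr ⟨j, m⟩)) +
        ∑ n ∈ Finset.range K, N.flow κ n ⬝ᵥ (fun s => N.B (N.regime n) s j) := fun K => by
    induction K with
    | zero => simp [flow_zero_inr]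
    | succ K ih =>
      rw [Finset.sum_range_succ, Finset.sum_range_succ, ih, hbal]
      ring
  simp only [hsum]
  have := hmass.add hout
  rw [zero_add] at this
  rwa [serverMatrix, ← Matrix.vecMul_vecMul]

/-- The expansion of the mean age over the last regime. -/
lemma hasSum_mul_flow_h : HasSum (fun n : ℕ => (n : ℝ) * (N.flow κ n ⬝ᵥ N.h))
    (∑ n ∈ Finset.range (N.τ J), (n : ℝ) * (N.flow κ n ⬝ᵥ N.h) +
      (N.β κ J ᵥ* ((N.τ J : ℝ) • (1 - N.A J)⁻¹ + (1 - N.A J)⁻¹ ^ 2 * N.A J)) ⬝ᵥ N.h) := by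
  rw [← hasSum_nat_add_iff' (N.τ J), add_sub_cancel_left]
  have h1 := hasSum_vecMul_pow_dotProduct (N.A_nonneg J) N.A_sum_le N.isUnit_one_sub_A
    (N.β κ J) N.h
  have h2 := hasSum_succ_mul_vecMul_pow_dotProduct (N.A_nonneg J) N.A_sum_le N.isUnit_one_sub_A
    (N.β κ J) N.h
  have hdet := (Matrix.isUnit_iff_isUnit_det _).1 N.isUnit_one_sub_A
  have hA : (1 - N.A J)⁻¹ ^ 2 * N.A J = (1 - N.A J)⁻¹ ^ 2 - (1 - N.A J)⁻¹ := by
    rw [show (1 - N.A J)⁻¹ ^ 2 * N.A J = (1 - N.A J)⁻¹ ^ 2 * (1 - (1 - N.A J)) by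
      rw [sub_sub_cancel], Matrix.mul_sub, Matrix.mul_one, pow_two, Matrix.mul_assoc,
      Matrix.nonsing_inv_mul _ hdet, Matrix.mul_one]
  have h3 := (h1.mul_left (N.τ J : ℝ)).add (h2.sub h1)
  rw [hA, Matrix.vecMul_add, Matrix.vecMul_sub, Matrix.vecMul_smul, add_dotProduct,
    sub_dotProduct, smul_dotProduct, smul_eq_mul]
  refine h3.congr_fun fun m => ?_
  rw [N.flow_eq κ le_rfl (Nat.le_add_left _ _) fun h => absurd h (lt_irrefl _),
    Nat.add_sub_cancel]
  push_cast
  ring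

/-! ### The multi-regime chain -/

section Chain

variable {κ} {Ω' : Type*} [MeasurableSpace Ω'] {ν : Measure Ω'} [IsProbabilityMeasure ν]
    {X : ℕ → Ω' → N.State}

/-- The probabilities of the transient states, which cannot be entered from absorbing ones. -/
lemma x_eq_flow (hX : N.IsMRAMC κ ν X) (n : ℕ) : N.x ν X n = N.flow κ n := by
  induction n with
  | zero => funext s; exact IsMarkovChain.real_zero hX _
  | succ n ih =>
    funext t
    rw [x, IsMarkovChain.real_succ hX, flow, ← ih]
    simp [absorbingMatrix, Matrix.vecMul, dotProduct, x]

lemma real_mem_C (hX : N.IsMRAMC κ ν X) (n : ℕ) :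
    ν.real {ω | X n ω ∈ N.C} = N.x ν X n ⬝ᵥ N.h := by
  have : {ω | X n ω ∈ N.C} =
      ⋃ t ∈ (Finset.univ : Finset N.Phase), {ω | X n ω = Sum.inl (Sum.inr t)} := by
    ext ω
    simp [C]
  rw [this, measureReal_biUnion_finset]
  · simp [dotProduct, h, x]
  · intro p _ p' _ hpp
    refine Set.disjoint_left.2 fun ω h1 h2 => hpp ?_
    simpa using h1.symm.trans h2
  · exact fun p _ => hX.1 n _

end Chain

end ServerSystem

/-! ### Machines with random input -/

/-- States of a machine with transition function `upd` fed with the inputs `v 0, v 1, …`. -/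
def drive {S E : Type*} (upd : S → E → S) (s₀ : S) (v : ℕ → E) : ℕ → S
  | 0 => s₀
  | i + 1 => upd (drive upd s₀ v i) (v i)

/-- States of a machine that, in state `s`, reads the entry `idx s` of the table `z` as its next
input. -/
def autoState {S Q E : Type*} (upd : S → E → S) (idx : S → Q) (s₀ : S) (z : Q → E) : ℕ → S
  | 0 => s₀
  | i + 1 => upd (autoState upd idx s₀ z i) (z (idx (autoState upd idx s₀ z i)))

/-- Inputs read by a machine from the table `z`. -/
def autoInput {S Q E : Type*} (upd : S → E → S) (idx : S → Q) (s₀ : S) (z : Q → E) (i : ℕ) : E :=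
  z (idx (autoState upd idx s₀ z i))

section Machine

variable {S Q E : Type*} (upd : S → E → S) (idx : S → Q) (s₀ : S)

lemma drive_congr {v w : ℕ → E} {n : ℕ} (h : ∀ i < n, v i = w i) :
    drive upd s₀ v n = drive upd s₀ w n := by
  induction n with
  | zero => rfl
  | succ n ih => rw [drive, drive, ih fun i hi => h i (by omega), h n (by omega)]

lemma drive_autoInput (z : Q → E) (i : ℕ) :
    drive upd s₀ (autoInput upd idx s₀ z) i = autoState upd idx s₀ z i := by
  induction i with
  | zero => rfl
  | succ i ih => rw [drive, ih]; rfl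

lemma autoInput_eq_iff (z : Q → E) (v : ℕ → E) (n : ℕ) :
    (∀ i < n, autoInput upd idx s₀ z i = v i) ↔ ∀ i < n, z (idx (drive upd s₀ v i)) = v i := by
  induction n with
  | zero => simp
  | succ n ih =>
    simp only [Nat.lt_succ_iff_lt_or_eq, or_imp, forall_and, forall_eq, ih]
    refine and_congr_right fun h => ?_
    rw [autoInput, ← drive_autoInput, drive_congr upd s₀ (ih.2 h)]

end Machine

/-- The inputs `e` follow the Markovian rule: given the past, the next input has the law `μ l`,
where `l` is the current state of the machine `nx` started in `l₀`. The measure is only assumed to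
be proportional to a probability measure. -/
structure IsDriven {L E Ω : Type*} [MeasurableSpace E] [MeasurableSpace Ω] (P : Measure Ω)
    (e : ℕ → Ω → E) (nx : L → E → L) (l₀ : L) (μ : L → Measure E) : Prop where
  measurable : ∀ i, Measurable (e i)
  cylinder : ∀ (n : ℕ) (v : ℕ → E), P {ω | ∀ i < n, e i ω = v i} =
    P Set.univ * ∏ i ∈ Finset.range n, μ (drive nx l₀ v i) {v i}

section Measurability

variable {S E Ω : Type*} [MeasurableSpace E] [MeasurableSpace Ω]

lemma measurableSet_prefix_eq [MeasurableSingletonClass E] (n : ℕ) (v : ℕ → E) :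
    MeasurableSet {x : ℕ → E | ∀ i < n, x i = v i} := by
  have : {x : ℕ → E | ∀ i < n, x i = v i} = ⋂ i ∈ Finset.range n, (fun x => x i) ⁻¹' {v i} := by
    ext x
    simp
  rw [this]
  exact Finset.measurableSet_biInter _ fun i _ =>
    measurable_pi_apply i (measurableSet_singleton _)

lemma measurableSet_drive_eq [Countable S] [Countable E] [MeasurableSingletonClass E]
    (upd : S → E → S) (s₀ : S) (i : ℕ) (s : S) :
    MeasurableSet {x : ℕ → E | drive upd s₀ x i = s} := by
  induction i generalizing s with
  | zero => exact MeasurableSet.const (s₀ = s)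
  | succ i ih =>
    have : {x : ℕ → E | drive upd s₀ x (i + 1) = s} =
        ⋃ t, {x | drive upd s₀ x i = t} ∩ (fun x => x i) ⁻¹' {a | upd t a = s} := by
      ext x
      simp [drive]
    rw [this]
    exact MeasurableSet.iUnion fun t =>
      (ih t).inter (measurable_pi_apply i (Set.to_countable _).measurableSet)

lemma measurable_autoInput {Q : Type*} [Countable S] [Countable E] [MeasurableSingletonClass E]
    (upd : S → E → S) (idx : S → Q) (s₀ : S) {Z : Q → Ω → E} (hZ : ∀ q, Measurable (Z q))
    (i : ℕ) : Measurable fun ω => autoInput upd idx s₀ (fun q => Z q ω) i := by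
  have hst : ∀ s, MeasurableSet {ω | autoState upd idx s₀ (fun q => Z q ω) i = s} := by
    induction i with
    | zero => exact fun s => MeasurableSet.const (s₀ = s)
    | succ i ih =>
      intro s
      have : {ω | autoState upd idx s₀ (fun q => Z q ω) (i + 1) = s} =
          ⋃ t, {ω | autoState upd idx s₀ (fun q => Z q ω) i = t} ∩
            Z (idx t) ⁻¹' {a | upd t a = s} := by
        ext ω
        simp [autoState]
      rw [this]
      exact MeasurableSet.iUnion fun t => (ih t).inter (hZ _ (Set.to_countable _).measurableSet)
  intro B hB
  have : (fun ω => autoInput upd idx s₀ (fun q => Z q ω) i) ⁻¹' B =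
      ⋃ t, {ω | autoState upd idx s₀ (fun q => Z q ω) i = t} ∩ Z (idx t) ⁻¹' B := by
    ext ω
    simp [autoInput]
  rw [this]
  exact MeasurableSet.iUnion fun t => (hst t).inter (hZ _ hB)

end Measurability

/-- A machine that never reads the same entry of a table of independent random variables twice. -/
lemma isDriven_autoInput {S Q L E Ω : Type*} [Countable S] [Countable E] [MeasurableSpace E]
    [MeasurableSingletonClass E] [MeasurableSpace Ω] {P : Measure Ω} [IsProbabilityMeasure P]
    {upd : S → E → S} {idx : S → Q} {s₀ : S} {Z : Q → Ω → E} (hZ : ∀ q, Measurable (Z q))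
    (hind : iIndepFun Z P) (hinj : ∀ v, Function.Injective fun i => idx (drive upd s₀ v i))
    {nx : L → E → L} {l₀ : L} {μ : L → Measure E} (lab : Q → L)
    (hlab : ∀ v i, lab (idx (drive upd s₀ v i)) = drive nx l₀ v i)
    (hlaw : ∀ q x, P (Z q ⁻¹' {x}) = μ (lab q) {x}) :
    IsDriven P (fun i ω => autoInput upd idx s₀ (fun q => Z q ω) i) nx l₀ μ where
  measurable := measurable_autoInput upd idx s₀ hZ
  cylinder n v := by
    have hset : {ω | ∀ i < n, autoInput upd idx s₀ (fun q => Z q ω) i = v i} =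
        ⋂ i ∈ Finset.range n, Z (idx (drive upd s₀ v i)) ⁻¹' {v i} := by
      ext ω
      simp [autoInput_eq_iff]
    rw [hset, measure_univ, one_mul]
    have h := (hind.precomp (hinj v)).measure_inter_preimage_eq_mul (Finset.range n)
      (sets := fun i => {v i}) fun i _ => measurableSet_singleton _
    rw [h]
    exact Finset.prod_congr rfl fun i _ => by rw [hlaw, hlab]

/-- A finite measure on sequences in a countable set is determined by the measures of the sets of
sequences with a given beginning. -/
lemma measure_ext_of_prefix {E : Type*} [Countable E] [MeasurableSpace E]
    [MeasurableSingletonClass E] {m m' : Measure (ℕ → E)} [IsFiniteMeasure m]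
    (h : ∀ (n : ℕ) (v : ℕ → E), m {x | ∀ i < n, x i = v i} = m' {x | ∀ i < n, x i = v i}) :
    m = m' := by
  rcases isEmpty_or_nonempty E with hE | ⟨⟨a₀⟩⟩
  · exact Measure.ext fun s _ => by
      rw [Set.eq_empty_of_isEmpty s, measure_empty, measure_empty]
  set C : Set (Set (ℕ → E)) := Set.range fun p : ℕ × (ℕ → E) => {x | ∀ i < p.1, x i = p.2 i}
    with hC
  refine ext_of_generate_finite C ?_ ?_ ?_ ?_
  · refine le_antisymm ?_ (MeasurableSpace.generateFrom_le ?_)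
    · refine iSup_le fun i => ?_
      rw [← measurable_iff_comap_le]
      refine @measurable_to_countable' E (ℕ → E) _ _ (MeasurableSpace.generateFrom C) _ fun a => ?_
      have : (fun x : ℕ → E => x i) ⁻¹' {a} = ⋃ p : Fin i → E,
          {x | ∀ k < i + 1, x k = if h : k < i then p ⟨k, h⟩ else a} := by
        ext x
        simp only [Set.mem_preimage, Set.mem_singleton_iff, Set.mem_iUnion, Set.mem_ofPred_eq]
        constructor
        · intro hx
          refine ⟨fun k => x k, fun k hk => ?_⟩
          split_ifs with h
          · rfl
          · rw [show k = i by omega, hx]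
        · rintro ⟨p, hp⟩
          simpa using hp i (Nat.lt_succ_self i)
      rw [this]
      exact @MeasurableSet.iUnion _ _ (MeasurableSpace.generateFrom C) _ _ fun p =>
        MeasurableSpace.measurableSet_generateFrom ⟨⟨i + 1, _⟩, rfl⟩
    · rintro _ ⟨p, rfl⟩
      exact measurableSet_prefix_eq _ _
  · rintro _ ⟨⟨n, v⟩, rfl⟩ _ ⟨⟨n', v'⟩, rfl⟩ ⟨y, hy, hy'⟩
    refine ⟨⟨max n n', y⟩, ?_⟩
    ext x
    simp only [Set.mem_ofPred_eq, Set.mem_inter_iff] at hy hy' ⊢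
    constructor
    · intro hx
      exact ⟨fun i hi => by rw [hx i (by omega), hy i hi],
        fun i hi => by rw [hx i (by omega), hy' i hi]⟩
    · rintro ⟨h1, h2⟩ i hi
      rcases lt_max_iff.1 hi with hi | hi
      · rw [h1 i hi, hy i hi]
      · rw [h2 i hi, hy' i hi]
  · rintro _ ⟨p, rfl⟩
    exact h _ _
  · simpa using h 0 fun _ => a₀

/-- The rule determines the law of the inputs up to a factor, and hence the almost sure events. -/
lemma IsDriven.ae_of_ae {L E Ω Ω' : Type*} [Countable E] [MeasurableSpace E]
    [MeasurableSingletonClass E] [MeasurableSpace Ω] [MeasurableSpace Ω'] {P : Measure Ω}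
    [IsFiniteMeasure P] {P' : Measure Ω'} [IsProbabilityMeasure P'] {e : ℕ → Ω → E}
    {e' : ℕ → Ω' → E} {nx : L → E → L} {l₀ : L} {μ : L → Measure E}
    (he : IsDriven P e nx l₀ μ) (he' : IsDriven P' e' nx l₀ μ) {G : Set (ℕ → E)}
    (hG : MeasurableSet G) (h : ∀ᵐ ω ∂P', (fun i => e' i ω) ∈ G) :
    ∀ᵐ ω ∂P, (fun i => e i ω) ∈ G := by
  have hm : Measurable fun ω i => e i ω := measurable_pi_lambda _ he.measurable
  have hm' : Measurable fun ω i => e' i ω := measurable_pi_lambda _ he'.measurable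
  have heq : P.map (fun ω i => e i ω) = P Set.univ • P'.map fun ω i => e' i ω := by
    refine measure_ext_of_prefix fun n v => ?_
    rw [Measure.map_apply hm (measurableSet_prefix_eq n v), Measure.smul_apply,
      Measure.map_apply hm' (measurableSet_prefix_eq n v)]
    have h1 := he.cylinder n v
    have h2 := he'.cylinder n v
    rw [measure_univ, one_mul] at h2
    simp only [Set.preimage_ofPred_eq, smul_eq_mul]
    rw [h1, h2]
  have h3 : ∀ᵐ x ∂(P'.map fun ω i => e' i ω), x ∈ G := (ae_map_iff hm'.aemeasurable hG).2 h
  refine (ae_map_iff hm.aemeasurable hG).1 ?_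
  rw [heq]
  exact Measure.ae_smul_measure h3 _

/-! ### The law of large numbers for driven inputs -/

lemma tendsto_comp_div_zero {A : ℕ → ℝ} (hA : Tendsto (fun m : ℕ => A m / m) atTop (𝓝 0))
    {N : ℕ → ℕ} (hN : ∀ n, N n ≤ n) : Tendsto (fun n : ℕ => A (N n) / n) atTop (𝓝 0) := by
  rw [Metric.tendsto_atTop] at hA ⊢
  intro ε hε
  obtain ⟨M, hM⟩ := hA (ε / 2) (half_pos hε)
  set C : ℝ := ∑ m ∈ Finset.range (M + 1), |A m| with hC
  have hC0 : 0 ≤ C := Finset.sum_nonneg fun _ _ => abs_nonneg _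
  obtain ⟨n₀, hn₀⟩ := exists_nat_gt (2 * C / ε)
  refine ⟨n₀ + 1, fun n hn => ?_⟩
  have hn1 : (0 : ℝ) < n := by exact_mod_cast (show 0 < n by omega)
  have hn2 : C < ε / 2 * n := by
    have h1 : (n₀ : ℝ) < n := by exact_mod_cast (show n₀ < n by omega)
    rw [div_lt_iff₀ hε] at hn₀
    nlinarith
  rw [dist_zero_right, Real.norm_eq_abs, abs_div, abs_of_pos hn1, div_lt_iff₀ hn1]
  rcases lt_or_ge (N n) (M + 1) with h | h
  · have h1 : |A (N n)| ≤ C :=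
      Finset.single_le_sum (f := fun m => |A m|) (fun _ _ => abs_nonneg _) (Finset.mem_range.2 h)
    nlinarith
  · have h1 := hM (N n) (by omega)
    have h2 : (0 : ℝ) < N n := by exact_mod_cast (show 0 < N n by omega)
    rw [dist_zero_right, Real.norm_eq_abs, abs_div, abs_of_pos h2, div_lt_iff₀ h2] at h1
    have h3 : (N n : ℝ) ≤ n := by exact_mod_cast hN n
    nlinarith

section Stacks

variable {L E : Type*} [DecidableEq L] (nx : L → E → L)

/-- The machine `nx` together with the numbers of visits to its states. -/
def countUpd (s : L × (L → ℕ)) (e : E) : L × (L → ℕ) :=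
  (nx s.1 e, Function.update s.2 s.1 (s.2 s.1 + 1))

variable (l₀ : L) (v : ℕ → E)

lemma drive_countUpd_fst (i : ℕ) :
    (drive (countUpd nx) (l₀, 0) v i).1 = drive nx l₀ v i := by
  induction i with
  | zero => rfl
  | succ i ih => rw [drive, countUpd, ih]; rfl

lemma drive_countUpd_snd_succ (i : ℕ) (l : L) :
    (drive (countUpd nx) (l₀, 0) v (i + 1)).2 l =
      (drive (countUpd nx) (l₀, 0) v i).2 l + if drive nx l₀ v i = l then 1 else 0 := by
  rw [drive, countUpd, drive_countUpd_fst]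
  split_ifs with h
  · simp [h]
  · simp [Function.update_of_ne (Ne.symm h)]

lemma drive_countUpd_snd_le (n : ℕ) (l : L) :
    (drive (countUpd nx) (l₀, 0) v n).2 l ≤ n := by
  induction n with
  | zero => exact le_rfl
  | succ n ih =>
    rw [drive_countUpd_snd_succ]
    split_ifs <;> omega

/-- The pair of the current state and of the number of its former visits never repeats. -/
lemma injective_stack_index : Function.Injective fun i =>
    ((drive (countUpd nx) (l₀, 0) v i).1,
      (drive (countUpd nx) (l₀, 0) v i).2 (drive (countUpd nx) (l₀, 0) v i).1) := by
  refine Function.Injective.of_lt_imp_ne fun i k hik h => ?_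
  simp only [drive_countUpd_fst, Prod.mk.injEq] at h
  obtain ⟨h1, h2⟩ := h
  have hmono : Monotone fun n => (drive (countUpd nx) (l₀, 0) v n).2 (drive nx l₀ v k) :=
    monotone_nat_of_le_succ fun n => by
      rw [drive_countUpd_snd_succ]
      exact Nat.le_add_right _ _
  have h3 := hmono (Nat.succ_le_of_lt hik)
  simp only [Nat.succ_eq_add_one] at h3
  rw [drive_countUpd_snd_succ, if_pos h1] at h3
  rw [h1] at h2
  omega

end Stacks

/-- **Law of large numbers** for driven inputs: the inputs read in a given state `l` average to
their mean, relative to the total number of inputs. -/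
theorem IsDriven.ae_tendsto {L E Ω : Type*} [Finite L] [DecidableEq L] [Countable E]
    [MeasurableSpace E] [MeasurableSingletonClass E] [MeasurableSpace Ω] {P : Measure Ω}
    [IsFiniteMeasure P] {e : ℕ → Ω → E} {nx : L → E → L} {l₀ : L} {μ : L → Measure E}
    [∀ l, IsProbabilityMeasure (μ l)] (he : IsDriven P e nx l₀ μ) (l : L) {φ : E → ℝ}
    (hφ : Integrable φ (μ l)) :
    ∀ᵐ ω ∂P, Tendsto (fun n : ℕ => (∑ i ∈ Finset.range n,
      if drive nx l₀ (fun i => e i ω) i = l then φ (e i ω) - ∫ x, φ x ∂μ l else 0) / n)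
      atTop (𝓝 0) := by
  have hφm : Measurable φ := measurable_of_countable φ
  -- The law of the inputs is also that of a machine that reads, at its `m`-th visit to state `l`,
  -- the entry `(l, m)` of an independent table; for it, the classical law applies to each column.
  obtain ⟨Ω', _, P', Z, hZ, hlaw, hind, _⟩ :=
    exists_hasLaw_indepFun (fun _ : L × ℕ => E) (fun q => μ q.1)
  have he' : IsDriven P' (fun i ω => autoInput (countUpd nx) (fun s => (s.1, s.2 s.1)) (l₀, 0)
      (fun q => Z q ω) i) nx l₀ μ :=
    isDriven_autoInput hZ hind (injective_stack_index nx l₀) Prod.fst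
      (drive_countUpd_fst nx l₀) fun q x =>
        (hlaw q).measure_eq (p := fun y => y ∈ ({x} : Set E)) (measurableSet_singleton x)
  refine he.ae_of_ae he' (G := {x | Tendsto (fun n : ℕ => (∑ i ∈ Finset.range n,
      if drive nx l₀ x i = l then φ (x i) - ∫ x, φ x ∂μ l else 0) / n) atTop (𝓝 0)}) ?_ ?_
  · refine measurableSet_tendsto (𝓝 0) fun n => ?_
    refine Measurable.div_const (Finset.measurable_sum _ fun i _ => ?_) _
    exact Measurable.ite (measurableSet_drive_eq nx l₀ i l)
      ((hφm.comp (measurable_pi_apply i)).sub_const _) measurable_const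
  · have hid : ∀ m, IdentDistrib (fun ω => φ (Z (l, m) ω)) (fun ω => φ (Z (l, 0) ω)) P' P' :=
      fun m => (IdentDistrib.mk (hZ _).aemeasurable (hZ _).aemeasurable
        ((hlaw (l, m)).map_eq.trans (hlaw (l, 0)).map_eq.symm)).comp hφm
    have hint : Integrable (fun ω => φ (Z (l, 0) ω)) P' := by
      have : Integrable φ (P'.map (Z (l, 0))) := by rw [(hlaw (l, 0)).map_eq]; exact hφ
      exact this.comp_measurable (hZ _)
    have hmean : ∫ ω, φ (Z (l, 0) ω) ∂P' = ∫ x, φ x ∂μ l := by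
      rw [← (hlaw (l, 0)).map_eq, integral_map (hZ _).aemeasurable hφm.aestronglyMeasurable]
    have hpair : Pairwise (Function.onFun (fun f g => IndepFun f g P')
        fun m ω => φ (Z (l, m) ω)) := fun m m' hm =>
      (hind.indepFun (i := (l, m)) (j := (l, m')) (by simpa using hm)).comp hφm hφm
    filter_upwards [strong_law_ae_real _ hint hpair hid] with ω hω
    rw [hmean] at hω
    set A : ℕ → ℝ := fun n => ∑ m ∈ Finset.range n, (φ (Z (l, m) ω) - ∫ x, φ x ∂μ l) with hA
    have hA0 : Tendsto (fun n : ℕ => A n / n) atTop (𝓝 0) := by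
      have h1 := hω.sub_const (∫ x, φ x ∂μ l)
      rw [sub_self] at h1
      refine h1.congr' ?_
      filter_upwards [eventually_gt_atTop 0] with n hn
      have hn' : (n : ℝ) ≠ 0 := by exact_mod_cast hn.ne'
      simp only [hA, Finset.sum_sub_distrib, Finset.sum_const, Finset.card_range, nsmul_eq_mul]
      field_simp
    set x : ℕ → E := fun i => autoInput (countUpd nx) (fun s => (s.1, s.2 s.1)) (l₀, 0)
      (fun q => Z q ω) i with hx
    refine (tendsto_comp_div_zero hA0 fun n => drive_countUpd_snd_le nx l₀ x n l).congr fun n => ?_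
    congr 1
    induction n with
    | zero => simp [hA, drive]
    | succ n ih =>
      rw [Finset.sum_range_succ, ← ih, drive_countUpd_snd_succ]
      split_ifs with h
      · have hst : autoState (countUpd nx) (fun s => (s.1, s.2 s.1)) (l₀, 0) (fun q => Z q ω) n =
            drive (countUpd nx) (l₀, 0) x n := (drive_autoInput _ _ _ _ n).symm
        have hxn : x n = Z (l, (drive (countUpd nx) (l₀, 0) x n).2 l) ω := by
          simp only [hx, autoInput]
          rw [hst, drive_countUpd_fst, h]
          rfl
        simp only [hA, Finset.sum_range_succ, ← hxn]
        rfl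
      · rw [add_zero, add_zero]

/-! ### Functionals of two consecutive inputs -/

lemma sum_range_eq_sum_even_add_sum_odd (D : ℕ → ℝ) (n : ℕ) :
    ∑ i ∈ Finset.range n, D i = ∑ k ∈ Finset.range ((n + 1) / 2), D (2 * k) +
      ∑ k ∈ Finset.range (n / 2), D (2 * k + 1) := by
  induction n with
  | zero => simp
  | succ n ih =>
    rw [Finset.sum_range_succ, ih]
    rcases Nat.even_or_odd' n with ⟨k, rfl | rfl⟩
    · rw [show (2 * k + 1) / 2 = k by omega, show (2 * k + 1 + 1) / 2 = k + 1 by omega,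
        show 2 * k / 2 = k by omega, Finset.sum_range_succ]
      ring
    · rw [show (2 * k + 1 + 1) / 2 = k + 1 by omega, show (2 * k + 1 + 1 + 1) / 2 = k + 1 by omega,
        show (2 * k + 1) / 2 = k by omega, Finset.sum_range_succ (fun k => D (2 * k + 1))]
      ring

lemma drive_shift {L E : Type*} (nx : L → E → L) (l₀ : L) (v : ℕ → E) (i : ℕ) :
    drive nx (nx l₀ (v 0)) (fun i => v (i + 1)) i = drive nx l₀ v (i + 1) := by
  induction i with
  | zero => rfl
  | succ i ih => rw [drive, ih]; rfl

lemma drive_pair {L E : Type*} (nx : L → E → L) (l₀ : L) (v : ℕ → E) (k : ℕ) :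
    drive (fun l (p : E × E) => nx (nx l p.1) p.2) l₀ (fun k => (v (2 * k), v (2 * k + 1))) k =
      drive nx l₀ v (2 * k) := by
  induction k with
  | zero => rfl
  | succ k ih => rw [drive, ih]; rfl

section Pairs

variable {L E Ω : Type*} [MeasurableSpace E] [MeasurableSingletonClass E] [MeasurableSpace Ω]
    {nx : L → E → L} {μ : L → Measure E} {P : Measure Ω} {e : ℕ → Ω → E} {l₀ : L}

/-- The rule persists after the first input. -/
lemma IsDriven.shift (he : IsDriven P e nx l₀ μ) (a : E) :
    IsDriven (P.restrict (e 0 ⁻¹' {a})) (fun i => e (i + 1)) nx (nx l₀ a) μ where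
  measurable i := he.measurable (i + 1)
  cylinder n v := by
    have hm0 : MeasurableSet (e 0 ⁻¹' {a}) := he.measurable 0 (measurableSet_singleton a)
    set w : ℕ → E := fun i => Nat.casesOn i a v with hw
    have h1 := he.cylinder 1 w
    have h2 := he.cylinder (n + 1) w
    rw [Finset.prod_range_succ', ← mul_assoc, mul_right_comm] at h2
    rw [Finset.prod_range_one] at h1
    have hs1 : {ω | ∀ i < 1, e i ω = w i} = e 0 ⁻¹' {a} := by
      ext ω
      simp [hw]
    have hs2 : {ω | ∀ i < n + 1, e i ω = w i} =
        {ω | ∀ i < n, e (i + 1) ω = v i} ∩ e 0 ⁻¹' {a} := by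
      ext ω
      simp only [Set.mem_ofPred_eq, Set.mem_inter_iff, Set.mem_preimage, Set.mem_singleton_iff]
      constructor
      · exact fun h => ⟨fun i hi => h (i + 1) (by omega), h 0 (by omega)⟩
      · rintro ⟨h3, h4⟩ i hi
        cases i with
        | zero => exact h4
        | succ i => exact h3 i (by omega)
    rw [Measure.restrict_apply_univ, Measure.restrict_apply' hm0, ← hs2, h2, ← hs1, h1]
    congr 1
    exact Finset.prod_congr rfl fun i _ => by rw [← drive_shift nx l₀ w i]; rfl

variable [Countable E]

/-- The law of two consecutive inputs, the first one being read in the state `l`. -/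
def pairLaw (nx : L → E → L) (μ : L → Measure E) (l : L) : Measure (E × E) :=
  μ l ⊗ₘ Kernel.ofFunOfCountable fun v => μ (nx l v)

instance isMarkovKernel_next [∀ l, IsProbabilityMeasure (μ l)] (l : L) :
    IsMarkovKernel (Kernel.ofFunOfCountable fun v => μ (nx l v)) :=
  ⟨fun v => inferInstanceAs (IsProbabilityMeasure (μ (nx l v)))⟩

instance isProbabilityMeasure_pairLaw [∀ l, IsProbabilityMeasure (μ l)] (l : L) :
    IsProbabilityMeasure (pairLaw nx μ l) :=
  inferInstanceAs (IsProbabilityMeasure (μ l ⊗ₘ _))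

lemma pairLaw_singleton [∀ l, IsProbabilityMeasure (μ l)] (l : L) (p : E × E) :
    pairLaw nx μ l {p} = μ l {p.1} * μ (nx l p.1) {p.2} := by
  rw [show ({p} : Set (E × E)) = {p.1} ×ˢ {p.2} by simp, pairLaw,
    Measure.compProd_apply_prod (measurableSet_singleton _) (measurableSet_singleton _),
    lintegral_singleton, mul_comm]
  rfl

/-- Inputs taken two by two again follow a rule of this kind. -/
lemma IsDriven.pair [∀ l, IsProbabilityMeasure (μ l)] (he : IsDriven P e nx l₀ μ) :
    IsDriven P (fun k ω => (e (2 * k) ω, e (2 * k + 1) ω))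
      (fun l (p : E × E) => nx (nx l p.1) p.2) l₀ (pairLaw nx μ) where
  measurable k := (he.measurable _).prodMk (he.measurable _)
  cylinder n v := by
    set w : ℕ → E := fun i => if i % 2 = 0 then (v (i / 2)).1 else (v (i / 2)).2 with hw
    have hw0 : ∀ k, w (2 * k) = (v k).1 := fun k => by simp [hw]
    have hw1 : ∀ k, w (2 * k + 1) = (v k).2 := fun k => by
      simp only [hw]
      rw [if_neg (by omega), show (2 * k + 1) / 2 = k by omega]
    have hwv : (fun k => (w (2 * k), w (2 * k + 1))) = v := by
      funext k
      rw [hw0, hw1]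
    have hset : {ω | ∀ k < n, (e (2 * k) ω, e (2 * k + 1) ω) = v k} =
        {ω | ∀ i < 2 * n, e i ω = w i} := by
      ext ω
      simp only [Set.mem_ofPred_eq]
      constructor
      · intro h i hi
        rcases Nat.even_or_odd' i with ⟨k, rfl | rfl⟩
        · rw [hw0, ← h k (by omega)]
        · rw [hw1, ← h k (by omega)]
      · intro h k hk
        rw [h _ (by omega), h _ (by omega), hw0, hw1]
    rw [hset, he.cylinder]
    congr 1
    clear hset
    induction n with
    | zero => simp
    | succ n ih =>
      rw [show 2 * (n + 1) = 2 * n + 1 + 1 by ring, Finset.prod_range_succ, Finset.prod_range_succ,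
        Finset.prod_range_succ, ih, pairLaw_singleton, mul_assoc, ← hwv, drive_pair]
      rfl

/-- **Law of large numbers** for functionals of two consecutive inputs. The pairs that start at an
even index do not overlap, and neither do those that start at an odd index. -/
theorem IsDriven.ae_tendsto_pair [Finite L] [DecidableEq L] [IsFiniteMeasure P]
    [∀ l, IsProbabilityMeasure (μ l)] (he : IsDriven P e nx l₀ μ) (l : L) {φ : E × E → ℝ}
    (hφ : Integrable φ (pairLaw nx μ l)) :
    ∀ᵐ ω ∂P, Tendsto (fun n : ℕ => (∑ i ∈ Finset.range n,
      if drive nx l₀ (fun i => e i ω) i = l then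
        φ (e i ω, e (i + 1) ω) - ∫ x, φ x ∂pairLaw nx μ l else 0) / n) atTop (𝓝 0) := by
  have heven := he.pair.ae_tendsto l hφ
  -- The pairs at odd indices are those at even indices after the removal of the first input.
  have hodd : ∀ᵐ ω ∂P, ∀ a, e 0 ω = a → Tendsto (fun n : ℕ => (∑ k ∈ Finset.range n,
      if drive nx l₀ (fun i => e i ω) (2 * k + 1) = l then
        φ (e (2 * k + 1) ω, e (2 * k + 1 + 1) ω) - ∫ x, φ x ∂pairLaw nx μ l else 0) / n)
        atTop (𝓝 0) := by
    rw [ae_all_iff]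
    intro a
    have h := (he.shift a).pair.ae_tendsto l hφ
    rw [ae_restrict_iff' (he.measurable 0 (measurableSet_singleton a))] at h
    filter_upwards [h] with ω hω ha
    refine (hω ha).congr fun n => ?_
    congr 1
    refine Finset.sum_congr rfl fun k _ => ?_
    rw [drive_pair nx (nx l₀ a) fun i => e (i + 1) ω, ← ha, drive_shift nx l₀ fun i => e i ω]
  filter_upwards [heven, hodd] with ω h0 h1
  simp only [drive_pair nx l₀ fun i => e i ω] at h0
  have h2 := (tendsto_comp_div_zero h0 (N := fun n => (n + 1) / 2) fun n => by omega).add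
    (tendsto_comp_div_zero (h1 _ rfl) (N := fun n => n / 2) fun n => by omega)
  rw [add_zero] at h2
  refine h2.congr fun n => ?_
  rw [← add_div]
  congr 1
  exact (sum_range_eq_sum_even_add_sum_odd (fun i => if drive nx l₀ (fun i => e i ω) i = l then
    φ (e i ω, e (i + 1) ω) - ∫ x, φ x ∂pairLaw nx μ l else 0) n).symm

end Pairs

/-! ### Frequencies of the states -/

section Frequencies

variable {L : Type*} [Fintype L] [DecidableEq L] {Q : Matrix L L ℝ} {κ : L → ℝ}

/-- If the empirical transition probabilities of a sequence converge to those of a stochastic matrix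
with a unique stationary law, then the empirical frequencies converge to this law: every cluster
point of the frequencies is a stationary law. -/
lemma tendsto_frequency (huniq : ∀ x : L → ℝ, (∀ l, 0 ≤ x l) → ∑ l, x l = 1 → x ᵥ* Q = x → x = κ)
    {l : ℕ → L} (htrans : ∀ a b, Tendsto (fun n : ℕ => (∑ i ∈ Finset.range n,
      if l i = a then (if l (i + 1) = b then (1 : ℝ) else 0) - Q a b else 0) / n) atTop (𝓝 0))
    (a : L) :
    Tendsto (fun n : ℕ => (∑ i ∈ Finset.range n, if l i = a then (1 : ℝ) else 0) / n) atTop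
      (𝓝 (κ a)) := by
  set u : ℕ → L → ℝ := fun n a => (∑ i ∈ Finset.range n, if l i = a then (1 : ℝ) else 0) / n
    with hu
  have hsimplex : ∀ᶠ n in atTop, u n ∈ stdSimplex ℝ L := by
    filter_upwards [eventually_gt_atTop 0] with n hn
    refine ⟨fun a => div_nonneg (Finset.sum_nonneg fun i _ => ?_) n.cast_nonneg, ?_⟩
    · split_ifs <;> norm_num
    · simp only [hu]
      rw [← Finset.sum_div, Finset.sum_comm]
      simp only [Finset.sum_ite_eq, Finset.mem_univ, if_true, Finset.sum_const, Finset.card_range,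
        nsmul_eq_mul, mul_one]
      exact div_self (by exact_mod_cast hn.ne')
  have hdiff : ∀ b, Tendsto (fun n => (u n ᵥ* Q) b - u n b) atTop (𝓝 0) := by
    intro b
    have h1 : Tendsto (fun n : ℕ => ((if l n = b then (1 : ℝ) else 0) -
        if l 0 = b then (1 : ℝ) else 0) / n) atTop (𝓝 0) := by
      refine squeeze_zero_norm (a := fun n : ℕ => 1 / (n : ℝ)) (fun n => ?_)
        tendsto_one_div_atTop_nhds_zero_nat
      rw [Real.norm_eq_abs, abs_div, Nat.abs_cast]
      refine div_le_div_of_nonneg_right ?_ n.cast_nonneg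
      split_ifs <;> norm_num
    have h2 := h1.sub (tendsto_finsetSum Finset.univ fun a _ => htrans a b)
    simp only [Finset.sum_const_zero, sub_zero] at h2
    refine h2.congr fun n => ?_
    have h3 : ∀ a, (∑ i ∈ Finset.range n,
        if l i = a then (if l (i + 1) = b then (1 : ℝ) else 0) - Q a b else 0) / n =
        (∑ i ∈ Finset.range n, if l i = a then (if l (i + 1) = b then (1 : ℝ) else 0) else 0) / n -
          u n a * Q a b := fun a => by
      simp only [hu]
      rw [div_mul_eq_mul_div, ← sub_div, Finset.sum_mul, ← Finset.sum_sub_distrib]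
      congr 1
      refine Finset.sum_congr rfl fun i _ => ?_
      split_ifs <;> ring
    simp only [h3, Finset.sum_sub_distrib]
    rw [← Finset.sum_div, Finset.sum_comm]
    simp only [Finset.sum_ite_eq, Finset.mem_univ, if_true]
    have h4 : ∑ i ∈ Finset.range n, (if l (i + 1) = b then (1 : ℝ) else 0) =
        (∑ i ∈ Finset.range n, if l i = b then (1 : ℝ) else 0) +
          ((if l n = b then (1 : ℝ) else 0) - if l 0 = b then (1 : ℝ) else 0) := by
      rw [← Finset.sum_range_sub (fun i => if l i = b then (1 : ℝ) else 0),
        ← Finset.sum_add_distrib]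
      exact Finset.sum_congr rfl fun i _ => by ring
    rw [h4]
    simp only [hu, Matrix.vecMul, dotProduct]
    ring
  have hlim : Tendsto u atTop (𝓝 κ) := by
    refine (isCompact_stdSimplex ℝ L).tendsto_nhds_of_unique_mapClusterPt hsimplex ?_
    intro x hx hxu
    refine huniq x hx.1 hx.2 ?_
    funext b
    have hcont : Continuous fun y : L → ℝ => (y ᵥ* Q) b - y b := by
      simp only [Matrix.vecMul, dotProduct]
      fun_prop
    have h1 : MapClusterPt ((x ᵥ* Q) b - x b) atTop fun n => (u n ᵥ* Q) b - u n b :=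
      hxu.continuousAt_comp hcont.continuousAt
    have h2 := (hdiff b)
    have h3 : ClusterPt ((x ᵥ* Q) b - x b) (𝓝 0) := ClusterPt.mono h1 h2
    have h4 : (x ᵥ* Q) b - x b = 0 := eq_of_nhds_neBot h3
    linarith
  exact tendsto_pi_nhds.1 hlim a

/-- Averages along a sequence whose states have frequencies `κ`, when the average over the visits to
each recurrent state is known and the other states are left for good. -/
lemma tendsto_average {l : ℕ → L} {a : ℕ → ℝ} {m : L → ℝ} (hκ : ∀ j, 0 ≤ κ j)
    (hfreq : ∀ j, Tendsto (fun n : ℕ =>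
      (∑ i ∈ Finset.range n, if l i = j then (1 : ℝ) else 0) / n) atTop (𝓝 (κ j)))
    (havg : ∀ j, 0 < κ j → Tendsto (fun n : ℕ =>
      (∑ i ∈ Finset.range n, if l i = j then a i - m j else 0) / n) atTop (𝓝 0))
    (hrec : ∃ i₀, ∀ i ≥ i₀, 0 < κ (l i)) :
    Tendsto (fun n : ℕ => (∑ i ∈ Finset.range n, a i) / n) atTop (𝓝 (∑ j, κ j * m j)) := by
  have h1 : ∀ j, Tendsto (fun n : ℕ => (∑ i ∈ Finset.range n, if l i = j then a i else 0) / n)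
      atTop (𝓝 (κ j * m j)) := by
    intro j
    rcases (hκ j).eq_or_lt with h0 | h0
    · obtain ⟨i₀, hi₀⟩ := hrec
      rw [← h0, zero_mul]
      refine (tendsto_const_div_atTop_nhds_zero_nat
        (∑ i ∈ Finset.range i₀, if l i = j then a i else 0)).congr' ?_
      filter_upwards [eventually_ge_atTop i₀] with n hn
      congr 1
      refine Finset.sum_subset (Finset.range_subset_range.2 hn) fun i _ hi => if_neg fun h => ?_
      have := hi₀ i (by simpa using hi)
      rw [h, ← h0] at this
      exact lt_irrefl _ this
    · have h2 := (havg j h0).add ((hfreq j).mul_const (m j))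
      rw [zero_add] at h2
      refine h2.congr fun n => ?_
      rw [div_mul_eq_mul_div, ← add_div, Finset.sum_mul, ← Finset.sum_add_distrib]
      congr 1
      refine Finset.sum_congr rfl fun i _ => ?_
      split_ifs <;> ring
  refine (tendsto_finsetSum Finset.univ fun j _ => h1 j).congr fun n => ?_
  rw [← Finset.sum_div, Finset.sum_comm]
  simp

/-- The support of the stationary law is closed, and entered sooner or later. -/
lemma eventually_pos_of_frequency {E : Type*} [MeasurableSpace E] {nx : L → E → L} {l₀ : L}
    {μ : L → Measure E} [∀ l, IsProbabilityMeasure (μ l)] (hκ : ∀ j, 0 ≤ κ j)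
    (hsum : ∑ j, κ j = 1) (hst : κ ᵥ* Q = κ)
    (hQ : ∀ a b, (μ a).real {v | nx a v = b} = Q a b) {v : ℕ → E}
    (hsupp : ∀ i, μ (drive nx l₀ v i) {v i} ≠ 0)
    (hfreq : ∀ j, Tendsto (fun n : ℕ => (∑ i ∈ Finset.range n,
      if drive nx l₀ v i = j then (1 : ℝ) else 0) / n) atTop (𝓝 (κ j))) :
    ∃ i₀, ∀ i ≥ i₀, 0 < κ (drive nx l₀ v i) := by
  obtain ⟨j, hj⟩ : ∃ j, 0 < κ j := by
    by_contra! h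
    have : ∑ j, κ j ≤ 0 := Finset.sum_nonpos fun j _ => h j
    linarith
  obtain ⟨i₀, hi₀⟩ : ∃ i, drive nx l₀ v i = j := by
    by_contra! h
    have h1 := hfreq j
    simp only [h, if_false, Finset.sum_const_zero, zero_div] at h1
    exact hj.ne (tendsto_nhds_unique tendsto_const_nhds h1)
  refine ⟨i₀, fun i hi => ?_⟩
  induction i, hi using Nat.le_induction with
  | base => rwa [hi₀]
  | succ i _ ih =>
    set a := drive nx l₀ v i with ha
    have hQpos : 0 < Q a (nx a (v i)) := by
      rw [← hQ]
      refine lt_of_lt_of_le ?_ (measureReal_mono (s₁ := {v i}) (by simp))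
      exact ENNReal.toReal_pos (hsupp i) (measure_ne_top _ _)
    have h2 : κ (nx a (v i)) = ∑ c, κ c * Q c (nx a (v i)) := (congrFun hst _).symm
    change 0 < κ (nx a (v i))
    rw [h2]
    refine Finset.sum_pos' (fun c _ => mul_nonneg (hκ c) ?_)
      ⟨a, Finset.mem_univ _, mul_pos ih hQpos⟩
    rw [← hQ]
    exact measureReal_nonneg

variable {E Ω : Type*} [Countable E] [MeasurableSpace E] [MeasurableSingletonClass E]
    [MeasurableSpace Ω] {P : Measure Ω} [IsFiniteMeasure P] {e : ℕ → Ω → E} {nx : L → E → L}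
    {l₀ : L} {μ : L → Measure E} [∀ l, IsProbabilityMeasure (μ l)]

/-- The states of a machine with driven inputs form a Markov chain with transition matrix `Q`, whose
frequencies converge to its unique stationary law. -/
lemma IsDriven.ae_tendsto_frequency (he : IsDriven P e nx l₀ μ)
    (hQ : ∀ a b, (μ a).real {v | nx a v = b} = Q a b)
    (huniq : ∀ x : L → ℝ, (∀ l, 0 ≤ x l) → ∑ l, x l = 1 → x ᵥ* Q = x → x = κ) :
    ∀ᵐ ω ∂P, ∀ l, Tendsto (fun n : ℕ => (∑ i ∈ Finset.range n,
      if drive nx l₀ (fun i => e i ω) i = l then (1 : ℝ) else 0) / n) atTop (𝓝 (κ l)) := by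
  have hm : ∀ a b, MeasurableSet {v | nx a v = b} := fun a b => (Set.to_countable _).measurableSet
  have h : ∀ᵐ ω ∂P, ∀ a b, Tendsto (fun n : ℕ => (∑ i ∈ Finset.range n,
      if drive nx l₀ (fun i => e i ω) i = a then
        (if nx a (e i ω) = b then (1 : ℝ) else 0) - Q a b else 0) / n) atTop (𝓝 0) := by
    rw [ae_all_iff]
    intro a
    rw [ae_all_iff]
    intro b
    have h1 := he.ae_tendsto a (φ := {v | nx a v = b}.indicator 1)
      ((integrable_const (1 : ℝ)).indicator (hm a b))
    rw [integral_indicator_one (hm a b), hQ] at h1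
    filter_upwards [h1] with ω hω
    refine hω.congr fun n => ?_
    simp only [Set.indicator_apply, Set.mem_ofPred_eq, Pi.one_apply]
  filter_upwards [h] with ω hω l
  refine tendsto_frequency huniq (fun a b => (hω a b).congr fun n => ?_) l
  congr 1
  refine Finset.sum_congr rfl fun i _ => ?_
  split_ifs with h1 h2 h3 h3
  · rfl
  · rw [drive, h1] at h3
    exact absurd h2 h3
  · rw [drive, h1] at h3
    exact absurd h3 h2
  all_goals rfl

end Frequencies

/-! ### Averages over random cycles -/

section Cycles

/-- The last index of a cycle that begins at or before `K`. -/
lemma exists_cycle_index {R : ℕ → ℕ} (hR : StrictMono R) : ∃ ρ : ℕ → ℕ, Tendsto ρ atTop atTop ∧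
    ∀ K ≥ R 0, R (ρ K) ≤ K ∧ K < R (ρ K + 1) := by
  refine ⟨fun K => Nat.findGreatest (fun n => R n ≤ K) K, ?_, fun K hK => ⟨?_, ?_⟩⟩
  · refine tendsto_atTop.2 fun m => ?_
    filter_upwards [eventually_ge_atTop (R m)] with K hK
    exact Nat.le_findGreatest (hR.le_apply.trans hK) hK
  · exact Nat.findGreatest_spec (P := fun n => R n ≤ K) (Nat.zero_le K) hK
  · by_contra! h
    have h1 : Nat.findGreatest (fun n => R n ≤ K) K + 1 ≤ K := (hR.le_apply).trans h
    exact Nat.findGreatest_is_greatest (P := fun n => R n ≤ K) (Nat.lt_succ_self _) h1 h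

lemma tendsto_succ_index {u : ℕ → ℝ} {a : ℝ} (h : Tendsto (fun n : ℕ => u n / n) atTop (𝓝 a)) :
    Tendsto (fun n : ℕ => u (n + 1) / n) atTop (𝓝 a) := by
  have h1 := (h.comp (tendsto_add_atTop_nat 1)).mul
    (tendsto_const_nhds (x := (1 : ℝ)).add tendsto_one_div_atTop_nhds_zero_nat)
  rw [add_zero, mul_one] at h1
  refine h1.congr' ?_
  filter_upwards [eventually_gt_atTop 0] with n hn
  have hn' : (n : ℝ) ≠ 0 := by exact_mod_cast hn.ne'
  have hn'' : (n : ℝ) + 1 ≠ 0 := by positivity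
  simp only [Function.comp_apply, Nat.cast_add, Nat.cast_one]
  field_simp

variable {R : ℕ → ℕ} {c : ℕ → ℝ} {T a : ℝ}

/-- The renewal-reward argument: the partial sums of a nonnegative sequence are squeezed between
their values at the ends of the cycles. -/
lemma tendsto_average_range_of_cycles (hR : StrictMono R)
    (hT : Tendsto (fun n : ℕ => (R n : ℝ) / n) atTop (𝓝 T)) (hT0 : 0 < T) (hc : ∀ k, 0 ≤ c k)
    (hcyc : Tendsto (fun n : ℕ =>
      (∑ i ∈ Finset.range n, ∑ k ∈ Finset.Ico (R i) (R (i + 1)), c k) / n) atTop (𝓝 a)) :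
    Tendsto (fun K : ℕ => (∑ k ∈ Finset.range K, c k) / K) atTop (𝓝 (a / T)) := by
  set C : ℕ → ℝ := fun K => ∑ k ∈ Finset.range K, c k with hC
  have hCmono : Monotone C := fun K K' h =>
    Finset.sum_le_sum_of_subset_of_nonneg (Finset.range_subset_range.2 h) fun k _ _ => hc k
  have hC0 : ∀ K, 0 ≤ C K := fun K => Finset.sum_nonneg fun k _ => hc k
  have hCR : Tendsto (fun n : ℕ => C (R n) / n) atTop (𝓝 a) := by
    have h1 := (tendsto_const_div_atTop_nhds_zero_nat (C (R 0))).add hcyc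
    rw [zero_add] at h1
    refine h1.congr fun n => ?_
    rw [← add_div]
    congr 1
    induction n with
    | zero => simp
    | succ n ih =>
      rw [Finset.sum_range_succ, ← add_assoc, ih]
      exact Finset.sum_range_add_sum_Ico _ (hR.monotone (Nat.le_succ n))
  have hratio : ∀ {u w : ℕ → ℝ}, Tendsto (fun n : ℕ => u n / n) atTop (𝓝 a) →
      Tendsto (fun n : ℕ => w n / n) atTop (𝓝 T) →
      Tendsto (fun n => u n / w n) atTop (𝓝 (a / T)) := fun {u w} hu hw => by
    refine (hu.div hw hT0.ne').congr' ?_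
    filter_upwards [eventually_gt_atTop 0] with n hn
    have hn' : (n : ℝ) ≠ 0 := by exact_mod_cast hn.ne'
    simp only [Pi.div_apply]
    rw [div_div_div_cancel_right₀ hn']
  obtain ⟨ρ, hρ, hρR⟩ := exists_cycle_index hR
  have hlow := (hratio hCR (tendsto_succ_index (u := fun n => (R n : ℝ)) hT)).comp hρ
  have hup := (hratio (tendsto_succ_index (u := fun n => C (R n)) hCR) hT).comp hρ
  refine tendsto_of_tendsto_of_tendsto_of_le_of_le' hlow hup ?_ ?_
  · filter_upwards [eventually_ge_atTop (R 0), eventually_gt_atTop 0] with K hK hK0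
    have h1 := hρR K hK
    have hK0' : (0 : ℝ) < K := by exact_mod_cast hK0
    exact div_le_div₀ (hC0 K) (hCmono h1.1) hK0' (by exact_mod_cast h1.2.le)
  · filter_upwards [eventually_ge_atTop (R 0), hρ.eventually_gt_atTop 0] with K hK hK0
    have h1 := hρR K hK
    have hR0 : (0 : ℝ) < R (ρ K) := by exact_mod_cast lt_of_lt_of_le hK0 hR.le_apply
    exact div_le_div₀ (hC0 _) (hCmono h1.2.le) hR0 (by exact_mod_cast h1.1)

/-- The same averages over the indices `1, …, K`. -/
lemma tendsto_average_of_cycles (hR : StrictMono R)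
    (hT : Tendsto (fun n : ℕ => (R n : ℝ) / n) atTop (𝓝 T)) (hT0 : 0 < T) (hc : ∀ k, 0 ≤ c k)
    (hcyc : Tendsto (fun n : ℕ =>
      (∑ i ∈ Finset.range n, ∑ k ∈ Finset.Ico (R i) (R (i + 1)), c k) / n) atTop (𝓝 a)) :
    Tendsto (fun K : ℕ => (∑ k ∈ Finset.Icc 1 K, c k) / K) atTop (𝓝 (a / T)) := by
  have h1 := (tendsto_succ_index (tendsto_average_range_of_cycles hR hT hT0 hc hcyc)).sub
    (tendsto_const_div_atTop_nhds_zero_nat (c 0))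
  rw [sub_zero] at h1
  refine h1.congr fun K => ?_
  rw [← sub_div]
  congr 1
  rw [Finset.range_eq_Ico, Finset.sum_eq_sum_Ico_succ_bot (Nat.succ_pos K), add_sub_cancel_left]
  rfl

end Cycles

namespace ServerSystem

variable {J : ℕ} (N : ServerSystem J)

/-- The sum of `f` over the ages between two successive receptions, when the service times of the
two packets are `p.1` and `p.2`: the age grows from `p.1` until the second packet, generated at age
`max p.1 τ₁`, is received. -/
def cycleSum (f : ℕ → ℝ) (p : ℕ × ℕ) : ℝ :=
  ∑ n ∈ Finset.Ico p.1 (max p.1 (N.τ 1) + p.2), f n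

variable [NeZero J] {σ : Fin J → ℕ → ℕ} (a₀ : ℕ)

lemma strictMono_reception (hσ : ∀ j g, 0 < σ j g) : StrictMono (N.reception σ a₀) := by
  refine strictMono_nat_of_lt_succ fun i => ?_
  have h1 : 0 < N.service σ a₀ (i + 1) := hσ _ _
  have h2 := le_max_left (N.service σ a₀ i) (N.τ 1)
  rw [reception, reception, packet_succ_fst]
  omega

lemma sum_cycle_age (hσ : ∀ j g, 0 < σ j g) (f : ℕ → ℝ) (i : ℕ) :
    ∑ k ∈ Finset.Ico (N.reception σ a₀ i) (N.reception σ a₀ (i + 1)), f (N.path σ a₀ k).age =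
      N.cycleSum f (N.service σ a₀ i, N.service σ a₀ (i + 1)) := by
  rw [N.sum_cycle a₀ hσ (fun _ s => f s.age), cycleSum]
  simp only
  rw [← Finset.sum_Ico_consecutive f (le_max_left (N.service σ a₀ i) (N.τ 1))
    (Nat.le_add_right _ (N.service σ a₀ (i + 1)))]
  congr 1
  · rw [packet_succ_fst, reception, Finset.sum_Ico_eq_sum_range, Finset.sum_Ico_eq_sum_range]
    refine Finset.sum_congr (by congr 1; omega) fun k _ => ?_
    congr 1
    omega
  · rw [Finset.sum_Ico_eq_sum_range, Nat.add_sub_cancel_left]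

open Classical in
lemma sum_cycle_started (hσ : ∀ j g, 0 < σ j g) (j : Fin J) (i : ℕ) :
    ∑ k ∈ Finset.Ico (N.reception σ a₀ i) (N.reception σ a₀ (i + 1)),
      (if (N.path σ a₀ k).ongoing = some (j, k) then (1 : ℝ) else 0) =
      if (N.packet σ a₀ (i + 1)).2 = j then 1 else 0 := by
  rw [N.sum_cycle a₀ hσ fun k s => if s.ongoing = some (j, k) then (1 : ℝ) else 0]
  have hpos : 0 < N.service σ a₀ (i + 1) := hσ _ _
  simp only [reduceCtorEq, if_false, Finset.sum_const_zero, zero_add, Option.some.injEq,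
    Prod.mk.injEq]
  rw [Finset.sum_eq_single_of_mem 0 (Finset.mem_range.2 hpos)]
  · simp
  · intro m _ hm
    exact if_neg fun h => hm (by omega)

open Classical in
lemma sum_cycle_received (hσ : ∀ j g, 0 < σ j g) (i : ℕ) :
    ∑ k ∈ Finset.Ico (N.reception σ a₀ i) (N.reception σ a₀ (i + 1)),
      (if (N.path σ a₀ k).Received σ (k + 1) then (1 : ℝ) else 0) = 1 := by
  rw [N.sum_cycle a₀ hσ fun k s => if s.Received σ (k + 1) then (1 : ℝ) else 0]
  have hpos : 0 < N.service σ a₀ (i + 1) := hσ _ _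
  have hnone : ∀ k a, ¬ (⟨a, none⟩ : LinkState J).Received σ k := fun k a => by
    simp [LinkState.Received]
  have hsome : ∀ k a j g, (⟨a, some (j, g)⟩ : LinkState J).Received σ k ↔ k = g + σ j g :=
    fun k a j g => by
      constructor
      · rintro ⟨j', g', h, hk⟩
        simp only [Option.some.injEq, Prod.mk.injEq] at h
        rw [hk, h.1, h.2]
      · exact fun h => ⟨j, g, rfl, h⟩
  simp only [hnone, hsome, if_false, Finset.sum_const_zero, zero_add]
  rw [Finset.sum_eq_single_of_mem (N.service σ a₀ (i + 1) - 1) (Finset.mem_range.2 (by omega))]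
  · refine if_pos ?_
    change (N.packet σ a₀ (i + 1)).1 + (N.service σ a₀ (i + 1) - 1) + 1 =
      (N.packet σ a₀ (i + 1)).1 + N.service σ a₀ (i + 1)
    omega
  · intro m _ hm
    refine if_neg fun h => hm ?_
    change (N.packet σ a₀ (i + 1)).1 + m + 1 =
      (N.packet σ a₀ (i + 1)).1 + N.service σ a₀ (i + 1) at h
    omega

end ServerSystem

/-! ### Expectations over a cycle -/

section SimpleSeries

variable {α : Type*} [Countable α] [MeasurableSpace α] [MeasurableSingletonClass α]
    {m : Measure α} [IsFiniteMeasure m] {C : ℕ → Set α} {f : ℕ → ℝ}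

lemma integrable_tsum_indicator (h : Summable fun n => |f n| * m.real (C n)) :
    Integrable (fun x => ∑' n, (C n).indicator (fun _ => f n) x) m := by
  refine ⟨(measurable_of_countable _).aestronglyMeasurable, ?_⟩
  have hmeas : ∀ n, MeasurableSet (C n) := fun n => (Set.to_countable _).measurableSet
  refine lt_of_le_of_lt (lintegral_mono fun x => enorm_tsum_le_tsum_enorm) ?_
  rw [lintegral_tsum fun n => (measurable_of_countable _).aemeasurable]
  have h1 : ∀ n, ∫⁻ x, ‖(C n).indicator (fun _ => f n) x‖ₑ ∂m =
      ENNReal.ofReal (|f n| * m.real (C n)) := fun n => by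
    simp only [enorm_indicator_eq_indicator_enorm]
    rw [lintegral_indicator_const (hmeas n), ENNReal.ofReal_mul (abs_nonneg _),
      ofReal_measureReal, Real.enorm_eq_ofReal_abs]
  simp only [h1]
  rw [← ENNReal.ofReal_tsum_of_nonneg (fun n => by positivity) h]
  exact ENNReal.ofReal_lt_top

lemma hasSum_integral_tsum_indicator (h : Summable fun n => |f n| * m.real (C n)) :
    HasSum (fun n => f n * m.real (C n)) (∫ x, ∑' n, (C n).indicator (fun _ => f n) x ∂m) := by
  have hmeas : ∀ n, MeasurableSet (C n) := fun n => (Set.to_countable _).measurableSet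
  have h1 := hasSum_integral_of_summable_integral_norm (μ := m)
    (F := fun n => (C n).indicator fun _ => f n)
    (fun n => (integrable_const (f n)).indicator (hmeas n)) ?_
  · refine h1.congr_fun fun n => ?_
    rw [integral_indicator_const _ (hmeas n), smul_eq_mul, mul_comm]
  · refine h.congr fun n => ?_
    simp only [norm_indicator_eq_indicator_norm]
    rw [integral_indicator_const _ (hmeas n), smul_eq_mul, mul_comm, Real.norm_eq_abs]

lemma tsum_indicator_lt (v : ℕ) : ∑' n, {w | n < w}.indicator (fun _ => (1 : ℝ)) v = v := by
  rw [tsum_eq_sum (s := Finset.range v)]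
  · rw [Finset.sum_congr rfl (g := fun _ => (1 : ℝ))]
    · simp
    · intro n hn
      exact Set.indicator_of_mem (by simpa using hn) _
  · intro n hn
    exact Set.indicator_of_notMem (by simpa using hn) _

end SimpleSeries

namespace ServerSystem

variable {J : ℕ} (N : ServerSystem J)

/-- The pairs of service times of two successive packets for which age `n` is taken between their
receptions. -/
def cycleSet (n : ℕ) : Set (ℕ × ℕ) :=
  {p | p.1 ≤ n ∧ n < max p.1 (N.τ 1) + p.2}

lemma tsum_cycleSet (f : ℕ → ℝ) (p : ℕ × ℕ) :
    ∑' n, (N.cycleSet n).indicator (fun _ => f n) p = N.cycleSum f p := by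
  have hmem : ∀ n, p ∈ N.cycleSet n ↔ n ∈ Finset.Ico p.1 (max p.1 (N.τ 1) + p.2) := fun n => by
    simp [cycleSet]
  rw [tsum_eq_sum (s := Finset.Ico p.1 (max p.1 (N.τ 1) + p.2))]
  · exact Finset.sum_congr rfl fun n hn => Set.indicator_of_mem ((hmem n).2 hn) _
  · exact fun n hn => Set.indicator_of_notMem (fun h => hn ((hmem n).1 h)) _

/-- The slots of a cycle in which the link is busy are those of the second service. -/
lemma cycleSum_busy (p : ℕ × ℕ) :
    N.cycleSum (fun n => if n < N.τ 1 then 0 else 1) p = p.2 := by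
  rw [cycleSum, ← Finset.sum_Ico_consecutive _ (le_max_left p.1 (N.τ 1)) (Nat.le_add_right _ _),
    Finset.sum_eq_zero, zero_add, Finset.sum_congr rfl (g := fun _ => (1 : ℝ))]
  · simp
  · intro n hn
    rw [Finset.mem_Ico] at hn
    exact if_neg (by omega)
  · intro n hn
    rw [Finset.mem_Ico] at hn
    exact if_pos (by omega)

/-- The measures `μ j` are the laws of the service times, expressed through their tails. -/
def IsServiceLaw (μ : Fin J → Measure ℕ) : Prop := ∀ j n, (μ j).real {v | n < v} = N.tail j n

variable {N} {μ : Fin J → Measure ℕ} [∀ j, IsProbabilityMeasure (μ j)]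

lemma IsServiceLaw.real_singleton (hμ : N.IsServiceLaw μ) (j : Fin J) (v : ℕ) :
    (μ j).real {v} = N.prob j v := by
  rw [prob, ← hμ, ← hμ]
  cases v with
  | zero =>
    have h1 : {v : ℕ | 0 < v} = {0}ᶜ := by
      ext v
      simp [Nat.pos_iff_ne_zero]
    have h2 : (μ j).real {v | 0 < v} = 1 := by rw [hμ, tail_zero]
    rw [h1, probReal_compl_eq_one_sub (measurableSet_singleton 0)] at h2
    simp only [zero_tsub, sub_self]
    linarith
  | succ v =>
    have h1 : {w : ℕ | v < w} = {v + 1} ∪ {w | v + 1 < w} := by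
      ext w
      simp only [Set.mem_ofPred_eq, Set.mem_union, Set.mem_singleton_iff]
      omega
    rw [Nat.add_sub_cancel, h1, measureReal_union _ (Set.to_countable _).measurableSet]
    · ring
    · simp

lemma IsServiceLaw.real_lt_add (hμ : N.IsServiceLaw μ) (j : Fin J) (a n : ℕ) :
    (μ j).real {w | n < a + w} = N.tail j (n - a) := by
  rcases lt_or_ge n a with h | h
  · rw [Nat.sub_eq_zero_of_le h.le, tail_zero,
      show {w : ℕ | n < a + w} = Set.univ from Set.eq_univ_of_forall fun w => by
        simp only [Set.mem_ofPred_eq]; omega]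
    exact probReal_univ
  · rw [← hμ]
    congr 1
    ext w
    simp only [Set.mem_ofPred_eq]
    omega

lemma IsServiceLaw.integrable (hμ : N.IsServiceLaw μ) (j : Fin J) :
    Integrable (fun v : ℕ => (v : ℝ)) (μ j) := by
  have h : Summable fun n => |(1 : ℝ)| * (μ j).real {v | n < v} := by
    simpa [hμ j] using (N.hasSum_tail j).summable
  simpa only [tsum_indicator_lt] using integrable_tsum_indicator h

lemma IsServiceLaw.hasSum_integral (hμ : N.IsServiceLaw μ) (j : Fin J) :
    HasSum (N.tail j) (∫ v : ℕ, (v : ℝ) ∂μ j) := by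
  have h : Summable fun n => |(1 : ℝ)| * (μ j).real {v | n < v} := by
    simpa [hμ j] using (N.hasSum_tail j).summable
  simpa only [tsum_indicator_lt, one_mul, hμ j] using hasSum_integral_tsum_indicator h

variable [NeZero J]

/-- The server of the next packet is a function of the service time. -/
lemma IsServiceLaw.serverMatrix_eq (hμ : N.IsServiceLaw μ) (l j : Fin J) :
    (μ l).real {v | N.server v = j} = N.serverMatrix l j := by
  have h1 := N.tendsto_sum_prob (Pi.single l 1) j
  rw [Matrix.single_one_vecMul] at h1
  have h2 : Tendsto (fun K : ℕ => (μ l).real ({v | N.server v = j} ∩ {v | v < K + 1})) atTop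
      (𝓝 ((μ l).real {v | N.server v = j})) := by
    have hmono : Monotone fun K : ℕ => {v | N.server v = j} ∩ {v | v < K + 1} :=
      fun K K' h v hv =>
        ⟨hv.1, show v < K' + 1 from lt_of_lt_of_le hv.2 (Nat.succ_le_succ h)⟩
    have h3 := tendsto_measure_iUnion_atTop (μ := μ l) hmono
    rw [show ⋃ K : ℕ, {v | N.server v = j} ∩ {v | v < K + 1} = {v | N.server v = j} by
      rw [← Set.inter_iUnion]
      exact Set.inter_eq_left.2 fun v _ => Set.mem_iUnion.2 ⟨v, Nat.lt_succ_self v⟩] at h3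
    exact (ENNReal.tendsto_toReal (measure_ne_top _ _)).comp h3
  refine tendsto_nhds_unique h2 (h1.congr fun K => ?_)
  have hset : {v | N.server v = j} ∩ {v | v < K + 1} =
      ⋃ v ∈ (Finset.range (K + 1)).filter (fun v => N.server v = j), {v} := by
    ext v
    simp [and_comm]
  rw [hset, measureReal_biUnion_finset]
  · rw [Finset.sum_filter, Finset.sum_range_succ']
    simp only [hμ.real_singleton, prob_zero, ite_self, add_zero]
    refine Finset.sum_congr rfl fun n _ => ?_
    congr 1
    rw [Finset.sum_eq_single l]
    · simp
    · intro i _ hi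
      simp [hi]
    · simp
  · exact fun v _ w _ hvw => Set.disjoint_singleton.2 hvw
  · exact fun v _ => measurableSet_singleton v

/-! ### Two successive service times -/

lemma pairLaw_real_prod (l : Fin J) {s B : Set ℕ} {b : ℝ}
    (hb : ∀ v ∈ s, (μ (N.server v)).real B = b) :
    (pairLaw (fun _ v => N.server v) μ l).real (s ×ˢ B) = (μ l).real s * b := by
  have hs : MeasurableSet s := (Set.to_countable _).measurableSet
  have h1 : (pairLaw (fun _ v => N.server v) μ l) (s ×ˢ B) = ∫⁻ _v in s, ENNReal.ofReal b ∂μ l := by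
    have : IsMarkovKernel (Kernel.ofFunOfCountable fun v => μ (N.server v)) :=
      isMarkovKernel_next (nx := fun _ v => N.server v) l
    rw [pairLaw, Measure.compProd_apply_prod hs (Set.to_countable _).measurableSet]
    refine setLIntegral_congr_fun hs fun v hv => ?_
    rw [← hb v hv, ofReal_measureReal]
    rfl
  rcases s.eq_empty_or_nonempty with rfl | ⟨v, hv⟩
  · simp
  · have hb0 : 0 ≤ b := by rw [← hb v hv]; exact measureReal_nonneg
    rw [measureReal_def, h1, setLIntegral_const, ENNReal.toReal_mul, ENNReal.toReal_ofReal hb0,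
      mul_comm]
    rfl

lemma IsServiceLaw.real_cycleSet (hμ : N.IsServiceLaw μ) (l : Fin J) (n : ℕ) :
    (pairLaw (fun _ v => N.server v) μ l).real (N.cycleSet n) =
      ∑ s ∈ Finset.range (n + 1), N.prob l s * N.tail (N.server s) (n - max s (N.τ 1)) := by
  have hset : N.cycleSet n =
      ⋃ s ∈ Finset.range (n + 1), ({s} : Set ℕ) ×ˢ {w | n < max s (N.τ 1) + w} := by
    ext p
    simp [cycleSet]
  rw [hset, measureReal_biUnion_finset]
  · refine Finset.sum_congr rfl fun s _ => ?_
    rw [pairLaw_real_prod l (b := N.tail (N.server s) (n - max s (N.τ 1))), hμ.real_singleton]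
    intro v hv
    rw [Set.mem_singleton_iff.1 hv, hμ.real_lt_add]
  · intro s _ s' _ hss
    exact Set.disjoint_left.2 fun p h1 h2 => hss (h1.1.symm.trans h2.1)
  · exact fun s _ => (Set.to_countable _).measurableSet

/-- The probability of `C` at time `n` is the probability that age `n` is taken during a stationary
cycle. -/
lemma IsServiceLaw.sum_real_cycleSet (hμ : N.IsServiceLaw μ) (κ : Fin J → ℝ) (n : ℕ) :
    ∑ l, κ l * (pairLaw (fun _ v => N.server v) μ l).real (N.cycleSet n) =
      N.flow κ n ⬝ᵥ N.h := by
  rw [flow_dotProduct_h]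
  simp only [hμ.real_cycleSet, Finset.mul_sum, Finset.sum_mul]
  rw [Finset.sum_comm]
  exact Finset.sum_congr rfl fun s _ => Finset.sum_congr rfl fun l _ => by ring

variable {κ : Fin J → ℝ} {f : ℕ → ℝ}

lemma flow_dotProduct_h_nonneg (hμ : N.IsServiceLaw μ) (hκ : ∀ l, 0 ≤ κ l) (n : ℕ) :
    0 ≤ N.flow κ n ⬝ᵥ N.h := by
  rw [← hμ.sum_real_cycleSet]
  exact Finset.sum_nonneg fun l _ => mul_nonneg (hκ l) measureReal_nonneg

lemma IsServiceLaw.summable_cycleSet (hμ : N.IsServiceLaw μ) (hκ : ∀ l, 0 ≤ κ l)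
    (hf : Summable fun n => |f n| * (N.flow κ n ⬝ᵥ N.h)) {l : Fin J} (hl : 0 < κ l) :
    Summable fun n => |f n| * (pairLaw (fun _ v => N.server v) μ l).real (N.cycleSet n) := by
  refine Summable.of_nonneg_of_le (fun n => by positivity) (fun n => ?_) (hf.mul_left (κ l)⁻¹)
  rw [mul_left_comm]
  refine mul_le_mul_of_nonneg_left ?_ (abs_nonneg _)
  rw [← div_eq_inv_mul, le_div_iff₀ hl, mul_comm, ← hμ.sum_real_cycleSet]
  exact Finset.single_le_sum (f := fun l =>
    κ l * (pairLaw (fun _ v => N.server v) μ l).real (N.cycleSet n))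
    (fun l _ => mul_nonneg (hκ l) measureReal_nonneg) (Finset.mem_univ l)

lemma IsServiceLaw.integrable_cycleSum (hμ : N.IsServiceLaw μ) (hκ : ∀ l, 0 ≤ κ l)
    (hf : Summable fun n => |f n| * (N.flow κ n ⬝ᵥ N.h)) {l : Fin J} (hl : 0 < κ l) :
    Integrable (N.cycleSum f) (pairLaw (fun _ v => N.server v) μ l) := by
  have := integrable_tsum_indicator (hμ.summable_cycleSet hκ hf hl)
  simpa only [tsum_cycleSet] using this

/-- The mean of a cycle sum in the stationary regime. States `l` with `κ l = 0` do not contribute,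
whatever the value of the integral, which may be a default value. -/
lemma IsServiceLaw.hasSum_cycleSum (hμ : N.IsServiceLaw μ) (hκ : ∀ l, 0 ≤ κ l)
    (hf : Summable fun n => |f n| * (N.flow κ n ⬝ᵥ N.h)) :
    HasSum (fun n => f n * (N.flow κ n ⬝ᵥ N.h))
      (∑ l, κ l * ∫ p, N.cycleSum f p ∂pairLaw (fun _ v => N.server v) μ l) := by
  have h1 : ∀ l, HasSum (fun n => κ l * (f n *
      (pairLaw (fun _ v => N.server v) μ l).real (N.cycleSet n)))
      (κ l * ∫ p, N.cycleSum f p ∂pairLaw (fun _ v => N.server v) μ l) := fun l => by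
    rcases (hκ l).eq_or_lt with h0 | h0
    · simp [← h0, hasSum_zero]
    · have := hasSum_integral_tsum_indicator (hμ.summable_cycleSet hκ hf h0)
      simp only [tsum_cycleSet] at this
      exact this.mul_left _
  refine (hasSum_sum fun l _ => h1 l).congr_fun fun n => ?_
  rw [← hμ.sum_real_cycleSet, Finset.mul_sum]
  exact Finset.sum_congr rfl fun l _ => by ring

/-- In the stationary regime, the second packet of a cycle has the same mean service time as the
first one. -/
lemma IsServiceLaw.hasSum_busy (hμ : N.IsServiceLaw μ) (hκ : N.IsStationary κ) :
    HasSum (fun n => (if n < N.τ 1 then 0 else 1) * (N.flow κ n ⬝ᵥ N.h))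
      (∑ j, κ j * ∫ v : ℕ, (v : ℝ) ∂μ j) := by
  have hf : Summable fun n => |if n < N.τ 1 then (0 : ℝ) else 1| * (N.flow κ n ⬝ᵥ N.h) := by
    refine Summable.of_nonneg_of_le
      (fun n => mul_nonneg (abs_nonneg _) (flow_dotProduct_h_nonneg hμ hκ.nonneg n))
      (fun n => mul_le_of_le_one_left (flow_dotProduct_h_nonneg hμ hκ.nonneg n) ?_)
      (N.hasSum_flow_h κ).summable
    split_ifs <;> norm_num
  have h1 := hμ.hasSum_cycleSum hκ.nonneg hf
  simp only [N.cycleSum_busy] at h1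
  have hlt : ∀ l n, (pairLaw (fun _ v => N.server v) μ l).real {p | n < p.2} =
      ∑ j, N.serverMatrix l j * N.tail j n := fun l n => by
    have hset : {p : ℕ × ℕ | n < p.2} =
        ⋃ j ∈ (Finset.univ : Finset (Fin J)), {v | N.server v = j} ×ˢ {w | n < w} := by
      ext p
      simp
    rw [hset, measureReal_biUnion_finset]
    · refine Finset.sum_congr rfl fun j _ => ?_
      rw [pairLaw_real_prod l (b := N.tail j n), hμ.serverMatrix_eq]
      intro v hv
      rw [show N.server v = j from hv, hμ]
    · intro s _ s' _ hss
      exact Set.disjoint_left.2 fun p h1 h2 => hss (h1.1.symm.trans h2.1)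
    · exact fun s _ => (Set.to_countable _).measurableSet
  have h2 : ∀ l, HasSum (fun n => ∑ j, N.serverMatrix l j * N.tail j n)
      (∫ p, (p.2 : ℝ) ∂pairLaw (fun _ v => N.server v) μ l) := fun l => by
    have h : Summable fun n => |(1 : ℝ)| *
        (pairLaw (fun _ v => N.server v) μ l).real {p | n < p.2} := by
      simp only [abs_one, one_mul, hlt]
      exact (hasSum_sum fun j _ => (N.hasSum_tail j).mul_left _).summable
    have h3 := hasSum_integral_tsum_indicator h
    simp only [one_mul, hlt] at h3
    convert h3 using 3 with p
    exact (tsum_indicator_lt p.2).symm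
  have h4 : ∀ l, ∫ p, (p.2 : ℝ) ∂pairLaw (fun _ v => N.server v) μ l =
      ∑ j, N.serverMatrix l j * ∫ v : ℕ, (v : ℝ) ∂μ j := fun l =>
    (h2 l).unique (hasSum_sum fun j _ => (hμ.hasSum_integral j).mul_left _)
  convert h1 using 1
  simp only [h4, Finset.mul_sum]
  rw [Finset.sum_comm]
  refine Finset.sum_congr rfl fun j _ => ?_
  conv_lhs => rw [← hκ.stationary]
  simp only [Matrix.vecMul, dotProduct, Finset.sum_mul, mul_assoc]

end ServerSystem

namespace ServerSystem

variable {J : ℕ} {N : ServerSystem J} {Ω : Type*} [MeasurableSpace Ω] {P : Measure Ω}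
    {S : Fin J → ℕ → Ω → ℕ}

/-! ### The random system -/

instance countable_linkState : Countable (LinkState J) :=
  Function.Injective.countable (f := fun s : LinkState J => (s.age, s.ongoing)) fun s t h => by
    cases s
    cases t
    simpa using h

lemma IsServiceFamily.measurableSet_path_eq (hS : N.IsServiceFamily P S) (a₀ k : ℕ)
    (s : LinkState J) : MeasurableSet {ω | N.path (fun j g => S j g ω) a₀ k = s} := by
  induction k generalizing s with
  | zero => exact MeasurableSet.const ((⟨a₀, N.decide 0 a₀⟩ : LinkState J) = s)
  | succ k ih =>
    have : {ω | N.path (fun j g => S j g ω) a₀ (k + 1) = s} =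
        ⋃ t, {ω | N.path (fun j g => S j g ω) a₀ k = t} ∩
          {ω | N.step (fun j g => S j g ω) (k + 1) t = s} := by
      ext ω
      simp [path]
    rw [this]
    refine MeasurableSet.iUnion fun t => (ih t).inter ?_
    obtain ⟨a, _ | ⟨j, g⟩⟩ := t
    · exact MeasurableSet.const ((⟨a + 1, N.decide (k + 1) (a + 1)⟩ : LinkState J) = s)
    · classical
      exact hS.measurable j g (Set.to_countable {v | (if k + 1 = g + v then
        (⟨k + 1 - g, N.decide (k + 1) (k + 1 - g)⟩ : LinkState J)
        else ⟨a + 1, some (j, g)⟩) = s}).measurableSet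

lemma IsServiceFamily.measurableSet_age_eq (hS : N.IsServiceFamily P S) (a₀ k n : ℕ) :
    MeasurableSet {ω | N.age S a₀ k ω = n} := by
  have : {ω | N.age S a₀ k ω = n} = ⋃ s ∈ {s : LinkState J | s.age = n},
      {ω | N.path (fun j g => S j g ω) a₀ k = s} := by
    ext ω
    simp [age]
  rw [this]
  exact MeasurableSet.biUnion (Set.to_countable _) fun s _ => hS.measurableSet_path_eq a₀ k s

lemma IsServiceFamily.integral_map (hS : N.IsServiceFamily P S) (j : Fin J) :
    ∫ v : ℕ, (v : ℝ) ∂P.map (S j 0) = ∫ ω, (S j 0 ω : ℝ) ∂P :=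
  MeasureTheory.integral_map (hS.measurable j 0).aemeasurable
    (measurable_of_countable _).aestronglyMeasurable

section Laws

variable [IsProbabilityMeasure P]

lemma IsServiceFamily.isServiceLaw (hS : N.IsServiceFamily P S) (g : ℕ) :
    N.IsServiceLaw fun j => P.map (S j g) := fun j n => by
  rw [map_measureReal_apply (hS.measurable j g) (Set.to_countable _).measurableSet]
  exact (hS.law j g).real_lt (hS.measurable j g) (N.α_sum j) n

lemma IsServiceFamily.isProbabilityMeasure_map (hS : N.IsServiceFamily P S) (j : Fin J) (g : ℕ) :
    IsProbabilityMeasure (P.map (S j g)) :=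
  Measure.isProbabilityMeasure_map (hS.measurable j g).aemeasurable

lemma IsServiceFamily.measure_preimage (hS : N.IsServiceFamily P S) (j : Fin J) (g v : ℕ) :
    P (S j g ⁻¹' {v}) = P.map (S j 0) {v} := by
  have h1 := fun g j => hS.isProbabilityMeasure_map j g
  rw [← Measure.map_apply (hS.measurable j g) (measurableSet_singleton v), ← ofReal_measureReal,
    ← ofReal_measureReal (μ := P.map (S j 0))]
  have h2 := have := h1 g; (hS.isServiceLaw g).real_singleton j v
  have h3 := have := h1 0; (hS.isServiceLaw 0).real_singleton j v
  rw [h2, h3]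

lemma IsServiceFamily.ae_pos (hS : N.IsServiceFamily P S) : ∀ᵐ ω ∂P, ∀ j g, 0 < S j g ω := by
  refine ae_all_iff.2 fun j => ae_all_iff.2 fun g => ?_
  have := (hS.law j g).real_eq_zero
  rw [measureReal_eq_zero_iff] at this
  rw [ae_iff]
  simpa using this

/-- Almost surely, all service times take values of positive probability. -/
lemma IsServiceFamily.ae_support (hS : N.IsServiceFamily P S) :
    ∀ᵐ ω ∂P, ∀ j g, P.map (S j 0) {S j g ω} ≠ 0 := by
  refine ae_all_iff.2 fun j => ae_all_iff.2 fun g => ?_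
  have hset : {ω | ¬ P.map (S j 0) {S j g ω} ≠ 0} =
      ⋃ v ∈ {v | P.map (S j 0) {v} = 0}, S j g ⁻¹' {v} := by
    ext ω
    simp
  rw [ae_iff, hset, measure_biUnion_null_iff (Set.to_countable _)]
  exact fun v hv => (hS.measure_preimage j g v).trans hv

lemma IsServiceFamily.integrable (hS : N.IsServiceFamily P S) (j : Fin J) (g : ℕ) :
    Integrable (fun ω => (S j g ω : ℝ)) P := by
  have := fun j => hS.isProbabilityMeasure_map j g
  exact ((hS.isServiceLaw g).integrable j).comp_measurable (hS.measurable j g)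

end Laws

/-! ### Almost sure limits of time averages -/

section Limits

/-- The steady-state law of the age: the probability that age `n` is taken during a stationary
cycle, divided by the mean cycle length. -/
def ageLaw (N : ServerSystem J) (κ : Fin J → ℝ) (n : ℕ) : ℝ :=
  (N.flow κ n ⬝ᵥ N.h) / N.meanCycle κ

lemma ageLaw_zero (N : ServerSystem J) (κ : Fin J → ℝ) : N.ageLaw κ 0 = 0 := by
  have : N.flow κ 0 ⬝ᵥ N.h = 0 := by
    simp [dotProduct, h, flow_zero_inr]
  rw [ageLaw, this, zero_div]

variable [NeZero J] [IsProbabilityMeasure P] {κ : Fin J → ℝ} (a₀ : ℕ)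

lemma packet_eq_autoState (σ : Fin J → ℕ → ℕ) (i : ℕ) : N.packet σ a₀ i =
    autoState N.nextPacket (fun p => (p.2, p.1)) (N.τ 1 - a₀, N.server a₀)
      (fun q : Fin J × ℕ => σ q.1 q.2) i := by
  induction i with
  | zero => rfl
  | succ i ih => rw [packet, ih]; rfl

lemma drive_server (σ : Fin J → ℕ → ℕ) (i : ℕ) :
    drive (fun _ v => N.server v) (N.server a₀) (N.service σ a₀) i = (N.packet σ a₀ i).2 := by
  cases i <;> rfl

/-- Different packets are generated in different slots, hence have independent service times. -/
lemma IsServiceFamily.isDriven (hS : N.IsServiceFamily P S) :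
    IsDriven P (fun i ω => N.service (fun j g => S j g ω) a₀ i) (fun _ v => N.server v)
      (N.server a₀) fun j => P.map (S j 0) := by
  have h := isDriven_autoInput (P := P) (upd := N.nextPacket) (idx := fun p => (p.2, p.1))
    (s₀ := (N.τ 1 - a₀, N.server a₀)) (Z := fun q : Fin J × ℕ => S q.1 q.2)
    (nx := fun _ v => N.server v) (l₀ := N.server a₀) (μ := fun j => P.map (S j 0))
    (fun q => hS.measurable q.1 q.2) hS.indep (fun v => ?_) Prod.fst (fun v i => ?_)
    fun q x => hS.measure_preimage q.1 q.2 x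
  · convert h using 3 with i ω
    rw [service, packet_eq_autoState]
    rfl
  · have hmono : StrictMono fun i =>
        (drive N.nextPacket (N.τ 1 - a₀, N.server a₀) v i).1 :=
      strictMono_nat_of_lt_succ fun i =>
        Nat.lt_add_of_pos_right (lt_of_lt_of_le N.τ_one_pos (le_max_right (v i) (N.τ 1)))
    exact fun i k hik => hmono.injective (Prod.mk.inj hik).2
  · cases i <;> rfl

variable {a₀}

lemma IsServiceFamily.ae_tendsto_frequency (hS : N.IsServiceFamily P S)
    (huniq : ∀ κ', N.IsStationary κ' → κ' = κ) :
    ∀ᵐ ω ∂P, ∀ j, Tendsto (fun n : ℕ => (∑ i ∈ Finset.range n,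
      if (N.packet (fun j g => S j g ω) a₀ i).2 = j then (1 : ℝ) else 0) / n) atTop
      (𝓝 (κ j)) := by
  have := fun j => hS.isProbabilityMeasure_map j 0
  have h := (hS.isDriven a₀).ae_tendsto_frequency (hS.isServiceLaw 0).serverMatrix_eq
    (κ := κ) fun x h0 h1 h2 => huniq x ⟨h0, h1, h2⟩
  simp only [drive_server] at h
  exact h

/-- The average of a cycle sum over the successive cycles. -/
lemma IsServiceFamily.ae_tendsto_cycleSum (hS : N.IsServiceFamily P S) (hκ : N.IsStationary κ)
    (huniq : ∀ κ', N.IsStationary κ' → κ' = κ) {f : ℕ → ℝ}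
    (hf : Summable fun n => |f n| * (N.flow κ n ⬝ᵥ N.h)) :
    ∀ᵐ ω ∂P, Tendsto (fun n : ℕ => (∑ i ∈ Finset.range n,
      N.cycleSum f (N.service (fun j g => S j g ω) a₀ i,
        N.service (fun j g => S j g ω) a₀ (i + 1))) / n) atTop
      (𝓝 (∑' n, f n * (N.flow κ n ⬝ᵥ N.h))) := by
  have := fun j => hS.isProbabilityMeasure_map j 0
  have hlaw := hS.isServiceLaw 0
  rw [(hlaw.hasSum_cycleSum hκ.nonneg hf).tsum_eq]
  have hpair : ∀ᵐ ω ∂P, ∀ l, 0 < κ l → Tendsto (fun n : ℕ => (∑ i ∈ Finset.range n,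
      if (N.packet (fun j g => S j g ω) a₀ i).2 = l then
        N.cycleSum f (N.service (fun j g => S j g ω) a₀ i,
          N.service (fun j g => S j g ω) a₀ (i + 1)) -
        ∫ x, N.cycleSum f x ∂pairLaw (fun _ v => N.server v) (fun j => P.map (S j 0)) l
      else 0) / n) atTop (𝓝 0) := by
    rw [ae_all_iff]
    intro l
    rcases (hκ.nonneg l).eq_or_lt with hl | hl
    · exact Eventually.of_forall fun ω h => absurd h (by rw [← hl]; exact lt_irrefl _)
    · filter_upwards [(hS.isDriven a₀).ae_tendsto_pair l
        (hlaw.integrable_cycleSum hκ.nonneg hf hl)] with ω hω _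
      simpa only [drive_server] using hω
  filter_upwards [hpair, hS.ae_tendsto_frequency (a₀ := a₀) huniq, hS.ae_support]
    with ω h1 h2 h3
  refine tendsto_average hκ.nonneg h2 h1 ?_
  have h4 := eventually_pos_of_frequency (nx := fun _ v => N.server v) (l₀ := N.server a₀)
    (μ := fun j => P.map (S j 0)) (v := N.service (fun j g => S j g ω) a₀)
    hκ.nonneg hκ.sum_eq_one hκ.stationary hlaw.serverMatrix_eq (fun i => ?_) ?_
  · simpa only [drive_server] using h4
  · rw [drive_server]
    exact h3 _ _
  · simpa only [drive_server] using h2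

/-- The mean cycle length is the mean of the cycle sum of the constant `1`. -/
lemma IsServiceFamily.ae_tendsto_reception (hS : N.IsServiceFamily P S) (hκ : N.IsStationary κ)
    (huniq : ∀ κ', N.IsStationary κ' → κ' = κ) :
    ∀ᵐ ω ∂P, Tendsto (fun n : ℕ => (N.reception (fun j g => S j g ω) a₀ n : ℝ) / n) atTop
      (𝓝 (N.meanCycle κ)) := by
  have hsum := N.hasSum_flow_h κ
  have h1 := hS.ae_tendsto_cycleSum (a₀ := a₀) hκ huniq (f := fun _ => 1)
    (by simpa using hsum.summable)
  simp only [one_mul, hsum.tsum_eq] at h1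
  filter_upwards [h1, hS.ae_pos] with ω hω hpos
  have h2 := (tendsto_const_div_atTop_nhds_zero_nat
    (N.reception (fun j g => S j g ω) a₀ 0 : ℝ)).add hω
  rw [zero_add] at h2
  refine h2.congr fun n => ?_
  rw [← add_div]
  congr 1
  induction n with
  | zero => simp
  | succ n ih =>
    rw [Finset.sum_range_succ, ← add_assoc, ih, ← N.sum_cycle_age a₀ hpos]
    have := (N.strictMono_reception a₀ hpos).monotone (Nat.le_succ n)
    simp only [Finset.sum_const, Nat.card_Ico, nsmul_eq_mul, mul_one, Nat.cast_sub this]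
    ring

lemma IsServiceFamily.meanCycle_pos (hS : N.IsServiceFamily P S) (hκ : N.IsStationary κ)
    (huniq : ∀ κ', N.IsStationary κ' → κ' = κ) : 0 < N.meanCycle κ := by
  obtain ⟨ω, h1, hpos⟩ := ((hS.ae_tendsto_reception (a₀ := 0) hκ huniq).and hS.ae_pos).exists
  refine lt_of_lt_of_le one_pos (ge_of_tendsto h1 ?_)
  filter_upwards [eventually_gt_atTop 0] with n hn
  rw [one_le_div (by exact_mod_cast hn)]
  exact_mod_cast (N.strictMono_reception 0 hpos).le_apply

/-- Time averages of nonnegative functions of the age. -/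
lemma IsServiceFamily.ae_tendsto_age_of_nonneg (hS : N.IsServiceFamily P S)
    (hκ : N.IsStationary κ) (huniq : ∀ κ', N.IsStationary κ' → κ' = κ) {f : ℕ → ℝ}
    (hf0 : ∀ n, 0 ≤ f n) (hf : Summable fun n => f n * N.ageLaw κ n) :
    ∀ᵐ ω ∂P, Tendsto (fun K : ℕ => (∑ k ∈ Finset.Icc 1 K, f (N.age S a₀ k ω)) / K) atTop
      (𝓝 (∑' n, f n * N.ageLaw κ n)) := by
  have hT := hS.meanCycle_pos hκ huniq
  have hf1 : Summable fun n => |f n| * (N.flow κ n ⬝ᵥ N.h) := by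
    refine (hf.mul_right (N.meanCycle κ)).congr fun n => ?_
    rw [abs_of_nonneg (hf0 n), ageLaw, mul_assoc, div_mul_cancel₀ _ hT.ne']
  have hval : ∑' n, f n * N.ageLaw κ n =
      (∑' n, f n * (N.flow κ n ⬝ᵥ N.h)) / N.meanCycle κ := by
    rw [← tsum_div_const]
    exact tsum_congr fun n => by rw [ageLaw, mul_div_assoc]
  rw [hval]
  filter_upwards [hS.ae_tendsto_cycleSum (a₀ := a₀) hκ huniq hf1,
    hS.ae_tendsto_reception (a₀ := a₀) hκ huniq, hS.ae_pos] with ω h1 h2 hpos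
  refine tendsto_average_of_cycles (N.strictMono_reception a₀ hpos) h2 hT
    (fun k => hf0 _) (h1.congr fun n => ?_)
  congr 1
  exact Finset.sum_congr rfl fun i _ => (N.sum_cycle_age a₀ hpos f i).symm

lemma IsServiceFamily.ageLaw_nonneg (hS : N.IsServiceFamily P S) (hκ : N.IsStationary κ)
    (huniq : ∀ κ', N.IsStationary κ' → κ' = κ) (n : ℕ) : 0 ≤ N.ageLaw κ n := by
  have := fun j => hS.isProbabilityMeasure_map j 0
  exact div_nonneg (flow_dotProduct_h_nonneg (hS.isServiceLaw 0) hκ.nonneg n)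
    (hS.meanCycle_pos hκ huniq).le

/-- Time averages of functions of the age. -/
lemma IsServiceFamily.ae_tendsto_age (hS : N.IsServiceFamily P S)
    (hκ : N.IsStationary κ) (huniq : ∀ κ', N.IsStationary κ' → κ' = κ) {f : ℕ → ℝ}
    (hf : Summable fun n => f n * N.ageLaw κ n) :
    ∀ᵐ ω ∂P, Tendsto (fun K : ℕ => (∑ k ∈ Finset.Icc 1 K, f (N.age S a₀ k ω)) / K) atTop
      (𝓝 (∑' n, f n * N.ageLaw κ n)) := by
  have hp0 := hS.ageLaw_nonneg hκ huniq
  have habs : Summable fun n => |f n| * N.ageLaw κ n := by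
    refine hf.abs.congr fun n => ?_
    rw [abs_mul, abs_of_nonneg (hp0 n)]
  have hpart : ∀ g : ℕ → ℝ, (∀ n, 0 ≤ g n) → (∀ n, g n ≤ |f n|) →
      Summable fun n => g n * N.ageLaw κ n := fun g h0 h1 =>
    Summable.of_nonneg_of_le (fun n => mul_nonneg (h0 n) (hp0 n))
      (fun n => mul_le_mul_of_nonneg_right (h1 n) (hp0 n)) habs
  have hs1 := hpart (fun n => max (f n) 0) (fun n => le_max_right _ _)
    fun n => max_le (le_abs_self _) (abs_nonneg _)
  have hs2 := hpart (fun n => max (-f n) 0) (fun n => le_max_right _ _)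
    fun n => max_le (neg_le_abs _) (abs_nonneg _)
  have hsplit : ∀ x : ℝ, max x 0 - max (-x) 0 = x := fun x => by
    rcases le_total x 0 with h | h
    · rw [max_eq_right h, max_eq_left (by linarith)]
      ring
    · rw [max_eq_left h, max_eq_right (by linarith)]
      ring
  filter_upwards [hS.ae_tendsto_age_of_nonneg (a₀ := a₀) hκ huniq (fun n => le_max_right _ _) hs1,
    hS.ae_tendsto_age_of_nonneg (a₀ := a₀) hκ huniq (fun n => le_max_right _ _) hs2] with ω h1 h2
  have h3 := h1.sub h2
  rw [← hs1.tsum_sub hs2] at h3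
  simp only [← sub_mul, hsplit, ← sub_div, ← Finset.sum_sub_distrib] at h3
  exact h3

/-- Frequency of the transmissions on a server. -/
lemma IsServiceFamily.ae_tendsto_started (hS : N.IsServiceFamily P S)
    (hκ : N.IsStationary κ) (huniq : ∀ κ', N.IsStationary κ' → κ' = κ) :
    ∀ᵐ ω ∂P, ∀ j, Tendsto (fun K : ℕ => (∑ k ∈ Finset.Icc 1 K, N.started S a₀ j k ω) / K) atTop
      (𝓝 (κ j / N.meanCycle κ)) := by
  filter_upwards [hS.ae_tendsto_frequency (a₀ := a₀) huniq,
    hS.ae_tendsto_reception (a₀ := a₀) hκ huniq, hS.ae_pos] with ω h1 h2 hpos j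
  refine tendsto_average_of_cycles (N.strictMono_reception a₀ hpos) h2
    (hS.meanCycle_pos hκ huniq) (fun k => ?_) ?_
  · rw [started]
    split_ifs <;> norm_num
  · have h3 := (tendsto_succ_index (h1 j)).sub (tendsto_const_div_atTop_nhds_zero_nat
      (if (N.packet (fun j g => S j g ω) a₀ 0).2 = j then (1 : ℝ) else 0))
    rw [sub_zero] at h3
    refine h3.congr fun n => ?_
    rw [← sub_div, Finset.sum_range_succ', add_sub_cancel_right]
    congr 1
    exact Finset.sum_congr rfl fun i _ => by
      simp only [started]
      convert (N.sum_cycle_started a₀ hpos j i).symm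

/-- Exactly one packet is received per cycle. -/
lemma IsServiceFamily.ae_tendsto_receptions (hS : N.IsServiceFamily P S)
    (hκ : N.IsStationary κ) (huniq : ∀ κ', N.IsStationary κ' → κ' = κ) :
    ∀ᵐ ω ∂P, Tendsto (fun K : ℕ => (K : ℝ) / N.receptions S a₀ K ω) atTop
      (𝓝 (N.meanCycle κ)) := by
  classical
  have hT := hS.meanCycle_pos hκ huniq
  filter_upwards [hS.ae_tendsto_reception (a₀ := a₀) hκ huniq, hS.ae_pos] with ω h2 hpos
  have h3 := tendsto_average_range_of_cycles (N.strictMono_reception a₀ hpos) h2 hT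
    (c := fun k => if (N.path (fun i g => S i g ω) a₀ k).Received (fun i g => S i g ω) (k + 1)
      then (1 : ℝ) else 0) (a := 1) (fun k => by split_ifs <;> norm_num) ?_
  · have h4 := h3.inv₀ (by positivity)
    rw [one_div, inv_inv] at h4
    refine h4.congr fun K => ?_
    rw [inv_div, Finset.sum_boole]
    congr 1
  · refine (tendsto_const_nhds (x := (1 : ℝ))).congr' ?_
    filter_upwards [eventually_gt_atTop 0] with n hn
    have hn' : (n : ℝ) ≠ 0 := by exact_mod_cast hn.ne'
    rw [Finset.sum_congr rfl fun i _ => (by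
      convert N.sum_cycle_received a₀ hpos i : _ = (1 : ℝ))]
    simp [hn']

end Limits

end ServerSystem

namespace ServerSystem

variable {J : ℕ} {N : ServerSystem J} {Ω : Type*} [MeasurableSpace Ω] {P : Measure Ω}
    {S : Fin J → ℕ → Ω → ℕ} [IsProbabilityMeasure P] {κ : Fin J → ℝ} {a₀ : ℕ}

/-! ### The steady-state law -/

/-- The mean of the age law. -/
lemma hasSum_mul_ageLaw (N : ServerSystem J) [NeZero J] (κ : Fin J → ℝ) :
    HasSum (fun n : ℕ => ((n + 1 : ℕ) : ℝ) * N.ageLaw κ (n + 1))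
      ((∑ n ∈ Finset.Ico 1 (N.τ J), (n : ℝ) * N.ageLaw κ n) +
        (N.β κ J ᵥ* ((N.τ J : ℝ) • (1 - N.A J)⁻¹ + (1 - N.A J)⁻¹ ^ 2 * N.A J)) ⬝ᵥ N.h
          / N.meanCycle κ) := by
  have hτ : 0 < N.τ J := lt_of_lt_of_le N.τ_one_pos
    (N.τ_mono (Nat.one_le_iff_ne_zero.2 (NeZero.ne J)) le_rfl)
  have h1 := (N.hasSum_mul_flow_h κ).div_const (N.meanCycle κ)
  have h2 : HasSum (fun n : ℕ => (n : ℝ) * N.ageLaw κ n)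
      ((∑ n ∈ Finset.Ico 1 (N.τ J), (n : ℝ) * N.ageLaw κ n) +
        (N.β κ J ᵥ* ((N.τ J : ℝ) • (1 - N.A J)⁻¹ + (1 - N.A J)⁻¹ ^ 2 * N.A J)) ⬝ᵥ N.h
          / N.meanCycle κ) := by
    rw [add_div, Finset.sum_div, Finset.range_eq_Ico, Finset.sum_eq_sum_Ico_succ_bot hτ] at h1
    simp only [mul_div_assoc, Nat.cast_zero, zero_mul, zero_div, zero_add] at h1
    exact h1
  have h3 := (hasSum_nat_add_iff' 1).2 h2
  simpa using h3

/-- Service times are at least `1`. -/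
lemma IsServiceFamily.meanService_pos (hS : N.IsServiceFamily P S) (hκ : N.IsStationary κ) :
    0 < ∑ l, κ l * ∫ ω, (S l 0 ω : ℝ) ∂P := by
  have := fun j => hS.isProbabilityMeasure_map j 0
  have hlaw := hS.isServiceLaw 0
  refine lt_of_lt_of_le one_pos ?_
  rw [← hκ.sum_eq_one]
  refine Finset.sum_le_sum fun l _ => le_mul_of_one_le_right (hκ.nonneg l) ?_
  rw [← hS.integral_map, ← N.tail_zero l]
  exact le_hasSum (hlaw.hasSum_integral l) 0 fun n _ => by
    rw [← hlaw]
    exact measureReal_nonneg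

variable [NeZero J]

lemma IsServiceFamily.hasSum_ageLaw (hS : N.IsServiceFamily P S)
    (hκ : N.IsStationary κ) (huniq : ∀ κ', N.IsStationary κ' → κ' = κ) :
    HasSum (N.ageLaw κ) 1 := by
  have h := (N.hasSum_flow_h κ).div_const (N.meanCycle κ)
  rwa [div_self (hS.meanCycle_pos hκ huniq).ne'] at h

lemma IsServiceFamily.ae_tendsto_card_age_eq (hS : N.IsServiceFamily P S)
    (hκ : N.IsStationary κ) (huniq : ∀ κ', N.IsStationary κ' → κ' = κ) (n : ℕ) :
    ∀ᵐ ω ∂P, Tendsto (fun K : ℕ =>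
      (((Finset.Icc 1 K).filter fun k => N.age S a₀ k ω = n).card : ℝ) / K)
        atTop (𝓝 (N.ageLaw κ n)) := by
  have hsum : HasSum (fun m => (if m = n then 1 else 0) * N.ageLaw κ m) (N.ageLaw κ n) := by
    refine (hasSum_ite_eq n (N.ageLaw κ n)).congr_fun fun m => ?_
    rcases eq_or_ne m n with rfl | hm
    · simp
    · simp [hm]
  have h := hS.ae_tendsto_age (a₀ := a₀) hκ huniq hsum.summable
  rw [hsum.tsum_eq] at h
  filter_upwards [h] with ω hω
  simpa only [Finset.sum_boole] using hω

/-- Averages of the age probabilities, by dominated convergence. -/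
lemma IsServiceFamily.tendsto_average_real_age_eq (hS : N.IsServiceFamily P S)
    (hκ : N.IsStationary κ) (huniq : ∀ κ', N.IsStationary κ' → κ' = κ) (n : ℕ) :
    Tendsto (fun K : ℕ => (∑ k ∈ Finset.Icc 1 K, P.real {ω | N.age S a₀ k ω = n}) / K) atTop
      (𝓝 (N.ageLaw κ n)) := by
  have hmeas := fun k => hS.measurableSet_age_eq a₀ k n
  have h := tendsto_integral_of_dominated_convergence (μ := P)
    (F := fun (K : ℕ) ω => (∑ k ∈ Finset.Icc 1 K,
      {ω | N.age S a₀ k ω = n}.indicator (1 : Ω → ℝ) ω) / K)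
    (f := fun _ => N.ageLaw κ n) (fun _ => 1) (fun K => ?_) (integrable_const 1) (fun K => ?_) ?_
  · simp only [integral_const, probReal_univ, one_smul] at h
    refine h.congr fun K => ?_
    have hint : ∀ k, Integrable ({ω | N.age S a₀ k ω = n}.indicator (1 : Ω → ℝ)) P :=
      fun k => (integrable_const (1 : ℝ)).indicator (hmeas k)
    rw [integral_div, integral_finsetSum _ fun k _ => hint k]
    simp only [integral_indicator_one (hmeas _)]
  · exact ((Finset.measurable_sum _ fun k _ =>
      measurable_one.indicator (hmeas k)).div_const _).aestronglyMeasurable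
  · refine Eventually.of_forall fun ω => ?_
    have h0 : 0 ≤ ∑ k ∈ Finset.Icc 1 K,
        {ω | N.age S a₀ k ω = n}.indicator (1 : Ω → ℝ) ω :=
      Finset.sum_nonneg fun k _ => Set.indicator_nonneg (fun _ _ => zero_le_one) _
    rw [Real.norm_of_nonneg (div_nonneg h0 K.cast_nonneg)]
    refine div_le_one_of_le₀ ?_ K.cast_nonneg
    refine (Finset.sum_le_card_nsmul _ _ 1 fun k _ => ?_).trans (by simp)
    exact Set.indicator_le_self' (fun _ _ => zero_le_one) _
  · filter_upwards [hS.ae_tendsto_card_age_eq (a₀ := a₀) hκ huniq n] with ω hω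
    refine hω.congr fun K => ?_
    rw [← Finset.sum_boole]
    congr 1
    exact Finset.sum_congr rfl fun k _ => by simp [Set.indicator_apply]

/-- The fraction of busy slots, those in which the age is at least `τ₁`. -/
lemma IsServiceFamily.one_sub_sum_ageLaw (hS : N.IsServiceFamily P S)
    (hκ : N.IsStationary κ) (huniq : ∀ κ', N.IsStationary κ' → κ' = κ) :
    1 - ∑ n ∈ Finset.Ico 1 (N.τ 1), N.ageLaw κ n =
      (∑ l, κ l * ∫ ω, (S l 0 ω : ℝ) ∂P) / N.meanCycle κ := by
  have := fun j => hS.isProbabilityMeasure_map j 0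
  have h1 := ((hS.isServiceLaw 0).hasSum_busy hκ).div_const (N.meanCycle κ)
  simp only [hS.integral_map] at h1
  have h2 : HasSum (fun n => (if n < N.τ 1 then 1 else 0) * N.ageLaw κ n)
      (∑ n ∈ Finset.range (N.τ 1), N.ageLaw κ n) := by
    rw [Finset.sum_congr rfl (g := fun n => (if n < N.τ 1 then 1 else 0) * N.ageLaw κ n)
      fun n hn => by rw [if_pos (Finset.mem_range.1 hn), one_mul]]
    exact hasSum_sum_of_ne_finset_zero fun n hn => by
      rw [if_neg (by simpa using hn), zero_mul]
  have h3 := (h1.add h2).unique ((hS.hasSum_ageLaw hκ huniq).congr_fun fun n => by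
    rw [ageLaw]
    split_ifs <;> ring)
  rw [Finset.range_eq_Ico, Finset.sum_eq_sum_Ico_succ_bot N.τ_one_pos, ageLaw_zero] at h3
  simp only [zero_add] at h3
  linarith

lemma IsServiceFamily.ae_tendsto_waiting (hS : N.IsServiceFamily P S)
    (hκ : N.IsStationary κ) (huniq : ∀ κ', N.IsStationary κ' → κ' = κ) :
    ∀ᵐ ω ∂P, Tendsto (fun K : ℕ => (∑ k ∈ Finset.Icc 1 K, N.waiting S a₀ k ω) / K) atTop
      (𝓝 (∑ n ∈ Finset.Ico 1 (N.τ 1), N.ageLaw κ n)) := by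
  have hsum : HasSum (fun n => (if n < N.τ 1 then 1 else 0) * N.ageLaw κ n)
      (∑ n ∈ Finset.Ico 1 (N.τ 1), N.ageLaw κ n) := by
    rw [Finset.sum_congr rfl (g := fun n => (if n < N.τ 1 then 1 else 0) * N.ageLaw κ n)
      fun n hn => by rw [if_pos (Finset.mem_Ico.1 hn).2, one_mul]]
    refine hasSum_sum_of_ne_finset_zero fun n hn => ?_
    rcases Nat.eq_zero_or_pos n with rfl | h0
    · rw [ageLaw_zero, mul_zero]
    · rw [if_neg fun h => hn (Finset.mem_Ico.2 ⟨h0, h⟩), zero_mul]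
  have h := hS.ae_tendsto_age (a₀ := a₀) hκ huniq hsum.summable
  rw [hsum.tsum_eq] at h
  filter_upwards [h] with ω hω
  refine hω.congr fun K => ?_
  congr 1
  refine Finset.sum_congr rfl fun k _ => ?_
  have hiff : (N.path (fun j g => S j g ω) a₀ k).ongoing = none ↔ N.age S a₀ k ω < N.τ 1 :=
    N.ongoing_eq_none_iff ..
  rw [waiting]
  by_cases hlt : N.age S a₀ k ω < N.τ 1
  · rw [if_pos hlt, if_pos (hiff.2 hlt)]
  · rw [if_neg hlt, if_neg (mt hiff.1 hlt)]

end ServerSystem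

end

theorem theorem3 {J : ℕ} (N : ServerSystem J)
    -- the stationary law of the server chain, which has no other one
    (κ : Fin J → ℝ) (hκ : N.IsStationary κ) (hκ_unique : ∀ κ', N.IsStationary κ' → κ' = κ)
    -- the update system
    {Ω : Type*} [MeasurableSpace Ω] (P : Measure Ω) [IsProbabilityMeasure P]
    (S : Fin J → ℕ → Ω → ℕ) (hS : N.IsServiceFamily P S) (a₀ : ℕ)
    -- the multi-regime absorbing Markov chain
    {Ω' : Type*} [MeasurableSpace Ω'] (ν : Measure Ω') [IsProbabilityMeasure ν]
    (X : ℕ → Ω' → N.State) (hX : N.IsMRAMC κ ν X) :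
    ∃ pΔ : ℕ → ℝ,
      -- `pΔ` is a pmf on the positive integers and the steady-state law of the age
      ((∀ n, 0 ≤ pΔ n) ∧ pΔ 0 = 0 ∧ HasSum pΔ 1) ∧
      (∀ n p, Tendsto (fun k => P.real {ω | N.age S a₀ k ω = n}) atTop (𝓝 p) → p = pΔ n) ∧
      (∀ n, Tendsto (fun K : ℕ => (∑ k ∈ Finset.Icc 1 K, P.real {ω | N.age S a₀ k ω = n}) / K)
        atTop (𝓝 (pΔ n))) ∧
      (∀ n, ∀ᵐ ω ∂P, Tendsto (fun K : ℕ =>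
          (((Finset.Icc 1 K).filter fun k => N.age S a₀ k ω = n).card : ℝ) / K)
        atTop (𝓝 (pΔ n))) ∧
      -- it is proportional to the probability of `C`, the constant being the mean cycle length
      (∀ n, ν.real {ω | X n ω ∈ N.C} = N.x ν X n ⬝ᵥ N.h ∧
        pΔ n = ν.real {ω | X n ω ∈ N.C} / N.meanCycle κ) ∧
      (0 < N.meanCycle κ ∧
        HasSum (fun n => ν.real {ω | X n ω ∈ N.C}) (N.meanCycle κ) ∧
        ∀ᵐ ω ∂P, Tendsto (fun K : ℕ => (K : ℝ) / N.receptions S a₀ K ω) atTop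
          (𝓝 (N.meanCycle κ))) ∧
      -- the explicit formula in each regime
      (∀ n r, r ≤ J → N.τ r ≤ n → (r < J → n < N.τ (r + 1)) →
        N.x ν X n = N.β κ r ᵥ* N.A r ^ (n - N.τ r) ∧
        pΔ n = ((N.β κ r ᵥ* N.A r ^ (n - N.τ r)) ⬝ᵥ N.h) / N.meanCycle κ) ∧
      -- the age cost
      (∀ f : ℕ → ℝ, Summable (fun n => f (n + 1) * pΔ (n + 1)) →
        ∀ᵐ ω ∂P, Tendsto (fun K : ℕ => (∑ k ∈ Finset.Icc 1 K, f (N.age S a₀ k ω)) / K) atTop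
          (𝓝 (∑' n, f (n + 1) * pΔ (n + 1)))) ∧
      HasSum (fun n : ℕ => ((n + 1 : ℕ) : ℝ) * pΔ (n + 1))
        ((∑ n ∈ Finset.Ico 1 (N.τ J), (n : ℝ) * pΔ n) +
          (N.β κ J ᵥ* ((N.τ J : ℝ) • (1 - N.A J)⁻¹ + (1 - N.A J)⁻¹ ^ 2 * N.A J)) ⬝ᵥ N.h
            / N.meanCycle κ) ∧
      -- the waiting probability, the server frequencies and the transmission cost
      (∀ᵐ ω ∂P, Tendsto (fun K : ℕ => (∑ k ∈ Finset.Icc 1 K, N.waiting S a₀ k ω) / K) atTop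
          (𝓝 (∑ n ∈ Finset.Ico 1 (N.τ 1), pΔ n))) ∧
      (∀ j g, Integrable (fun ω => (S j g ω : ℝ)) P) ∧
      (∃ freq : Fin J → ℝ,
        (∀ j, freq j = (1 - ∑ n ∈ Finset.Ico 1 (N.τ 1), pΔ n) *
          (κ j / ∑ l, κ l * ∫ ω, (S l 0 ω : ℝ) ∂P)) ∧
        (∀ j, ∀ᵐ ω ∂P, Tendsto
          (fun K : ℕ => (∑ k ∈ Finset.Icc 1 K, N.started S a₀ j k ω) / K) atTop (𝓝 (freq j))) ∧
        ∀ᵐ ω ∂P, Tendsto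
          (fun K : ℕ => (∑ k ∈ Finset.Icc 1 K, ∑ j, N.cost j * N.started S a₀ j k ω) / K) atTop
          (𝓝 (∑ j, N.cost j * freq j))) := by
  -- There is at least one server because the entries of `κ` add up to `1`.
  have : NeZero J := ⟨by
    rintro rfl
    simpa using hκ.sum_eq_one⟩
  have hu := hκ_unique
  have hT := hS.meanCycle_pos hκ hu
  have hbusy := hS.one_sub_sum_ageLaw hκ hu
  have hfreq : ∀ j, κ j / N.meanCycle κ = (1 - ∑ n ∈ Finset.Ico 1 (N.τ 1), N.ageLaw κ n) *
      (κ j / ∑ l, κ l * ∫ ω, (S l 0 ω : ℝ) ∂P) := fun j => by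
    rw [hbusy]
    have := (hS.meanService_pos hκ).ne'
    field_simp
  have hC : ∀ n, ν.real {ω | X n ω ∈ N.C} = N.flow κ n ⬝ᵥ N.h := fun n => by
    rw [N.real_mem_C hX, N.x_eq_flow hX]
  refine ⟨N.ageLaw κ, ⟨hS.ageLaw_nonneg hκ hu, N.ageLaw_zero κ, hS.hasSum_ageLaw hκ hu⟩,
    fun n p hp => ?_, hS.tendsto_average_real_age_eq hκ hu, hS.ae_tendsto_card_age_eq hκ hu,
    fun n => ⟨N.real_mem_C hX n, by rw [hC, ServerSystem.ageLaw]⟩,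
    ⟨hT, by simpa only [hC] using N.hasSum_flow_h κ, hS.ae_tendsto_receptions hκ hu⟩,
    fun n r hr h1 h2 => ?_, fun f hf => ?_, N.hasSum_mul_ageLaw κ,
    hS.ae_tendsto_waiting hκ hu, hS.integrable, fun j => κ j / N.meanCycle κ, hfreq, ?_, ?_⟩
  · refine tendsto_nhds_unique ?_ (hS.tendsto_average_real_age_eq (a₀ := a₀) hκ hu n)
    -- A limit is also the limit of the averages.
    have h1 := (hp.comp (tendsto_add_atTop_nat 1)).cesaro
    refine h1.congr fun K => ?_
    rw [← div_eq_inv_mul]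
    congr 1
    change ∑ i ∈ Finset.range K, P.real {ω | N.age S a₀ (i + 1) ω = n} = _
    rw [Finset.range_eq_Ico, Finset.sum_Ico_add' (fun k => P.real {ω | N.age S a₀ k ω = n})]
    rfl
  · have h3 := N.flow_eq κ hr h1 h2
    exact ⟨(N.x_eq_flow hX n).trans h3, by rw [ServerSystem.ageLaw, h3]⟩
  · have hf' : Summable fun n => f n * N.ageLaw κ n := (summable_nat_add_iff 1).1 hf
    have h1 := hS.ae_tendsto_age (a₀ := a₀) hκ hu hf'
    rwa [hf'.tsum_eq_zero_add, N.ageLaw_zero, mul_zero, zero_add] at h1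
  · exact fun j => (hS.ae_tendsto_started hκ hu).mono fun ω hω => hω j
  · filter_upwards [hS.ae_tendsto_started (a₀ := a₀) hκ hu] with ω hω
    refine (tendsto_finsetSum Finset.univ fun j _ => (hω j).const_mul (N.cost j)).congr
      fun K => ?_
    rw [Finset.sum_comm, Finset.sum_div]
    exact Finset.sum_congr rfl fun j _ => by rw [← Finset.mul_sum, mul_div_assoc]
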